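/- All graphs are finite and simple. For integers $r\ge 3$ and $1\le s\le r-1$, let $\mathrm{PX}(2,r,s)$ be the graph with vertex set $\mathbb{Z}_2^s\times\mathbb{Z}_r$ and edges $\{(n_0,n_1,\ldots,n_{s-1},x),(n_1,\ldots,n_{s-1},n_s,x+1)\}$ for $n_0,\dots,n_s\in\mathbb{Z}_2$, $x\in\mathbb{Z}_r$. For $\underline n=(n_1,\ldots,n_{s-1})\in\mathbb{Z}_2^{s-1}$ and $x\in\mathbb{Z}_r$, let $C_{\underline n,x}$ be the 4-cycle $((0,\underline n,x),(\underline n,0,x+1),(1,\underline n,x),(\underline n,1,x+1))$ of $\mathrm{PX}(2,r,s)$, and let $\mathcal C$ be the set of all these cycles; it is a decomposition of the edge set of $\mathrm{PX}(2,r,s)$. The split graph $\mathrm{S}(\mathrm{PX}(2,r,s))$ has as vertices the pairs $(v,C)$ where $C\in\mathcal C$ and $v$ is a vertex of $C$; two vertices $(v_1,C_1)$ and $(v_2,C_2)$ are adjacent if and only if either $C_1\ne C_2$ and $v_1=v_2$, or $C_1=C_2$ and $\{v_1,v_2\}$ is an edge of $C_1$. **Theorem 1.2.** Let $\Gamma$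 be a connected cubic (that is, 3-regular) graph and let $G$ be a subgroup of $\mathrm{Aut}(\Gamma)$ that is transitive on the vertices of $\Gamma$. Suppose that $G$ has an abelian normal subgroup $N$ that is not semiregular, that is, some non-identity element of $N$ fixes a vertex of $\Gamma$. Then $\Gamma$ is isomorphic to the complete graph $K_4$, the complete bipartite graph $K_{3,3}$, the 3-cube $Q_3$, or $\mathrm{S}(\mathrm{PX}(2,r,s))$ for some $r\ge 3$ and $1\le s\le r-1$. -/

import Mathlib

/-- A group of graph automorphisms is transitive on vertices. -/
def IsVertexTransitive {V : Type*} {Γ : SimpleGraph V} (G : Subgroup (Γ ≃g Γ)) : Prop :=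
  ∀ u v : V, ∃ g ∈ G, g u = v

/-- A group of automorphisms is semiregular (on vertices) if only its identity element fixes
a vertex, that is, if all its vertex stabilisers are trivial. -/
def IsSemiregular {V : Type*} {Γ : SimpleGraph V} (N : Subgroup (Γ ≃g Γ)) : Prop :=
  ∀ g ∈ N, ∀ v : V, g v = v → g = 1

/-- The `n`-dimensional cube: binary words of length `n`, two of them being adjacent when they
differ in exactly one place. -/
def cubeGraph (n : ℕ) : SimpleGraph (Fin n → ZMod 2) where
  Adj u v := hammingDist u v = 1
  symm := ⟨fun u v h => by rw [hammingDist_comm]; exact h⟩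
  loopless := ⟨fun u h => by simp at h⟩

/-- The Praeger-Xu graph `PX(2, r, s)` (meant for `3 ≤ r` and `1 ≤ s ≤ r - 1`): the edges are the
pairs `{(n₀, …, n_{s-1}, x), (n₁, …, n_s, x + 1)}`. -/
def praegerXu (r s : ℕ) : SimpleGraph ((Fin s → ZMod 2) × ZMod r) :=
  SimpleGraph.fromRel fun u v =>
    ∃ (n : Fin (s + 1) → ZMod 2) (x : ZMod r),
      u = (fun i => n i.castSucc, x) ∧ v = (fun i => n i.succ, x + 1)

/-- For `n = (n₁, …, n_{s-1})`, the word `(a, n₁, …, n_{s-1})` of length `s`. -/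
def wordCons {s : ℕ} (a : ZMod 2) (n : Fin (s - 1) → ZMod 2) : Fin s → ZMod 2 :=
  fun i => if h : i.val = 0 then a else n ⟨i.val - 1, by omega⟩

/-- For `n = (n₁, …, n_{s-1})`, the word `(n₁, …, n_{s-1}, b)` of length `s`. -/
def wordSnoc {s : ℕ} (n : Fin (s - 1) → ZMod 2) (b : ZMod 2) : Fin s → ZMod 2 :=
  fun i => if h : i.val < s - 1 then n ⟨i.val, h⟩ else b

theorem praegerXu_adj_of_ne {r s : ℕ} (n : Fin (s - 1) → ZMod 2) (x : ZMod r) (a b : ZMod 2)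
    (h : ((wordCons a n, x) : (Fin s → ZMod 2) × ZMod r) ≠ (wordSnoc n b, x + 1)) :
    (praegerXu r s).Adj (wordCons a n, x) (wordSnoc n b, x + 1) := by
  rw [praegerXu, SimpleGraph.fromRel_adj]
  refine ⟨h, Or.inl ⟨fun i => if h0 : i.val = 0 then a else
    if h1 : i.val - 1 < s - 1 then n ⟨i.val - 1, h1⟩ else b, x, ?_, ?_⟩⟩
  · refine Prod.ext (funext fun i => ?_) rfl
    by_cases h0 : i.val = 0
    · simp [wordCons, h0]
    · have h1 : i.val - 1 < s - 1 := by omega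
      simp [wordCons, h0, h1]
  · refine Prod.ext (funext fun i => ?_) rfl
    simp [wordSnoc]

/-- The 4-cycle `C_{n,x} = ((0, n, x), (n, 0, x + 1), (1, n, x), (n, 1, x + 1))` of `PX(2, r, s)`,
as a subgraph; its four edges are the pairs `{(a, n, x), (n, b, x + 1)}` with `a, b ∈ ℤ₂`.
(The condition `u ≠ v` is automatic for `r ≥ 2`.) -/
def naturalCycle (r s : ℕ) (n : Fin (s - 1) → ZMod 2) (x : ZMod r) :
    (praegerXu r s).Subgraph where
  verts := {v | ∃ a : ZMod 2, v = (wordCons a n, x) ∨ v = (wordSnoc n a, x + 1)}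
  Adj u v := u ≠ v ∧ ∃ a b : ZMod 2,
    (u = (wordCons a n, x) ∧ v = (wordSnoc n b, x + 1)) ∨
    (v = (wordCons a n, x) ∧ u = (wordSnoc n b, x + 1))
  adj_sub := by
    rintro u v ⟨hne, a, b, ⟨rfl, rfl⟩ | ⟨rfl, rfl⟩⟩
    · exact praegerXu_adj_of_ne n x a b hne
    · exact (praegerXu_adj_of_ne n x a b hne.symm).symm
  edge_vert := by
    rintro u v ⟨_, a, b, ⟨rfl, _⟩ | ⟨_, rfl⟩⟩
    · exact ⟨a, Or.inl rfl⟩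
    · exact ⟨b, Or.inr rfl⟩
  symm := ⟨by
    rintro u v ⟨hne, a, b, h⟩
    exact ⟨hne.symm, a, b, h.symm⟩⟩

/-- The natural cycle decomposition `{C_{n,x} : n ∈ ℤ₂^{s-1}, x ∈ ℤ_r}` of `PX(2, r, s)`. -/
def naturalCycleDecomposition (r s : ℕ) : Set (praegerXu r s).Subgraph :=
  {C | ∃ (n : Fin (s - 1) → ZMod 2) (x : ZMod r), C = naturalCycle r s n x}

/-- The split graph of a graph `Λ` with respect to a set `𝒞` of subgraphs (meant for a cycle
decomposition of a 4-valent graph): the vertices are the pairs `(v, C)` with `C ∈ 𝒞` and `v` on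
`C`; two pairs are adjacent when they have the same vertex and different cycles, or the same cycle
`C` and vertices that form an edge of `C`. -/
def splitGraph {V : Type*} (Λ : SimpleGraph V) (𝒞 : Set Λ.Subgraph) :
    SimpleGraph {p : V × Λ.Subgraph // p.2 ∈ 𝒞 ∧ p.1 ∈ p.2.verts} where
  Adj p q := (p.1.2 ≠ q.1.2 ∧ p.1.1 = q.1.1) ∨ (p.1.2 = q.1.2 ∧ p.1.2.Adj p.1.1 q.1.1)
  symm := ⟨by
    rintro p q (⟨h, h'⟩ | ⟨h, h'⟩)
    · exact Or.inl ⟨h.symm, h'.symm⟩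
    · exact Or.inr ⟨h.symm, h ▸ h'.symm⟩⟩
  loopless := ⟨by
    rintro p (⟨h, _⟩ | ⟨_, h⟩)
    · exact h rfl
    · exact h.ne rfl⟩

/-- The graph `S(PX(2, r, s))`. -/
def splitPraegerXu (r s : ℕ) :=
  splitGraph (praegerXu r s) (naturalCycleDecomposition r s)

/-! Stabilisers in `N` are conjugate under the transitive group, so by finiteness an inclusion
between two of them is an equality; by connectedness every `N_v` then moves a neighbour of `v`
(`exists_fixer_moves`). Since `N` is abelian, `N_v` depends only on the `N`-orbit of `v`.

If no `N_v` fixes a neighbour of `v`, it is transitive on the three neighbours, and commutativity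
makes all neighbours of a vertex have equal neighbourhoods: the graph is `K₃₃`. Otherwise `N_v`
fixes exactly one neighbour `f v` and swaps the other two; `f` is an invariant perfect matching and
the remaining edges form 4-cycles (`nonempty_iso_or_isMatchedCubic`). If some `v` and `f v` lie on a
common 4-cycle, the graph is `K₄`. If not, it is bipartite (`IsMatchedCubic.exists_coloring`), and
contracting the matching gives a digraph of in- and out-valency two whose arcs fall into alternating
4-cycles.

Such a digraph is a shift digraph, by induction on its order (`IsAltDigraph.exists_equiv_shiftRel`).
Out-neighbourhoods pair the vertices into twins. Either twins also share in-neighbours, and the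
digraph is a directed cycle with doubled vertices (`s = 1`), or the twin classes form a smaller
digraph of the same kind, and undoing this quotient lengthens the words by one letter. Each quotient
also lengthens a walk fixed by an element of `N` by one arc, while in the doubled cycle a walk
meeting every layer is fixed only by the identity. This yields `s + 1 ≤ r`. Splitting the vertices
again gives `S(PX(2, r, s))` for `r ≥ 3`, and the cube for `r = 2`. -/

section Fixers

/-! ### Point stabilisers in an abelian normal subgroup -/

variable {G : Type*} [Group G] {N : Subgroup G} {V : Type*} [MulAction G V]

/-- The stabiliser of a point in a subgroup of the acting group. -/
def fixer (N : Subgroup G) (v : V) : Subgroup G := N ⊓ MulAction.stabilizer G v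

theorem mem_fixer {n : G} {v : V} : n ∈ fixer N v ↔ n ∈ N ∧ n • v = v := by
  simp [fixer]

theorem fixer_smul_of_comm (hc : ∀ m ∈ N, ∀ n ∈ N, m * n = n * m) {n : G} (hn : n ∈ N) (v : V) :
    fixer N (n • v) = fixer N v := by
  ext m
  simp only [mem_fixer, and_congr_right_iff]
  intro hm
  rw [smul_smul, hc m hm n hn, ← smul_smul]
  exact smul_left_cancel_iff n

theorem conj_mem_fixer [hN : N.Normal] (g : G) {n : G} {v : V} (h : n ∈ fixer N v) :
    g * n * g⁻¹ ∈ fixer N (g • v) := by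
  rw [mem_fixer] at h ⊢
  refine ⟨hN.conj_mem n h.1 g, ?_⟩
  simp [mul_smul, h.2]

/-- Conjugation by an element of `G` taking one point to the other shows that the two stabilisers
have the same finite order. -/
theorem fixer_eq_of_le [Finite G] [N.Normal] (htrans : ∀ a b : V, ∃ g : G, g • a = b) {u v : V}
    (h : fixer N u ≤ fixer N v) : fixer N u = fixer N v := by
  have key : Nat.card (fixer N v) ≤ Nat.card (fixer N u) := by
    obtain ⟨g, rfl⟩ := htrans v u
    refine Nat.card_le_card_of_injective
      (fun n : fixer N v => (⟨g * n * g⁻¹, conj_mem_fixer g n.2⟩ : fixer N (g • v))) ?_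
    intro a b hab
    simpa using hab
  exact Subgroup.eq_of_le_of_card_ge h key

/-- If a normal subgroup `N` of a transitive group preserving a connected relation `R` is not
semiregular, then the stabiliser in `N` of any point `v` moves some `w` with `R v w`. -/
theorem exists_fixer_moves [Finite G] [hN : N.Normal] {R : V → V → Prop}
    (hR : ∀ (g : G) (a b : V), R (g • a) (g • b) ↔ R a b)
    (htrans : ∀ a b : V, ∃ g : G, g • a = b) (hconn : ∀ a b, Relation.EqvGen R a b)
    (hfaith : ∀ n ∈ N, (∀ v : V, n • v = v) → n = 1)
    (hns : ∃ n ∈ N, n ≠ 1 ∧ ∃ v : V, n • v = v) (v : V) :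
    ∃ w, R v w ∧ ∃ n ∈ N, n • v = v ∧ n • w ≠ w := by
  -- Otherwise stabilisers are constant along `R`, hence everywhere by connectedness, and a
  -- nonidentity element with one fixed point would fix all points.
  by_contra! hcon
  have hle : ∀ u w, R u w → fixer N u ≤ fixer N w := by
    intro u w huw n hn
    obtain ⟨g, rfl⟩ := htrans v u
    rw [mem_fixer] at hn ⊢
    refine ⟨hn.1, ?_⟩
    have h1 := hcon (g⁻¹ • w) (by rw [← hR g]; simpa using huw) (g⁻¹ * n * g)
      (by simpa using hN.conj_mem n hn.1 g⁻¹) (by simp [mul_smul, hn.2])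
    simpa [mul_smul] using congrArg (g • ·) h1
  have heq : ∀ u w, Relation.EqvGen R u w → fixer N u = fixer N w := by
    intro u w h
    induction h with
    | rel u w h => exact fixer_eq_of_le htrans (hle u w h)
    | refl => rfl
    | symm _ _ _ ih => exact ih.symm
    | trans _ _ _ _ _ ih1 ih2 => exact ih1.trans ih2
  obtain ⟨n, hn, hn1, u, hu⟩ := hns
  refine hn1 (hfaith n hn fun w => ?_)
  have : n ∈ fixer N u := mem_fixer.2 ⟨hn, hu⟩
  rw [heq u w (hconn u w)] at this
  exact (mem_fixer.1 this).2

end Fixers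

/-! ### Alternating digraphs and their twin quotients -/

/-- A connected digraph of in- and out-valency two in which any two vertices with a common
out-neighbour have the same out-neighbours, with a vertex-transitive group `G` of automorphisms
and a subgroup `N` acting faithfully but not semiregularly. -/
structure IsAltDigraph {G : Type*} [Group G] (N : Subgroup G) {A : Type*} [MulAction G A]
    (R : A → A → Prop) : Prop where
  smul_iff : ∀ (g : G) (a b : A), R (g • a) (g • b) ↔ R a b
  trans : ∀ a b : A, ∃ g : G, g • a = b
  out : ∀ a, ∃ b b', b ≠ b' ∧ ∀ c, R a c ↔ c = b ∨ c = b'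
  inn : ∀ a, ∃ b b', b ≠ b' ∧ ∀ c, R c a ↔ c = b ∨ c = b'
  alt : ∀ {a a' b b'}, R a b → R a' b → R a b' → R a' b'
  conn : ∀ a b, Relation.EqvGen R a b
  faithful : ∀ n ∈ N, (∀ a : A, n • a = a) → n = 1
  nonsemi : ∃ n ∈ N, n ≠ 1 ∧ ∃ a : A, n • a = a

/-- The digraph on words of length `s` placed on a cycle of length `r`: an arc shifts the word
and moves one step along the cycle. -/
def shiftRel (r s : ℕ) (u v : (Fin s → ZMod 2) × ZMod r) : Prop :=
  v.2 = u.2 + 1 ∧ ∀ i j : Fin s, i.val = j.val + 1 → u.1 i = v.1 j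

namespace IsAltDigraph

variable {G : Type*} [Group G] {N : Subgroup G} {A : Type*} [MulAction G A] {R : A → A → Prop}

theorem exists_out (h : IsAltDigraph N R) (a : A) : ∃ b, R a b := by
  obtain ⟨b, b', -, hb⟩ := h.out a
  exact ⟨b, (hb b).2 (Or.inl rfl)⟩

theorem exists_inn (h : IsAltDigraph N R) (a : A) : ∃ b, R b a := by
  obtain ⟨b, b', -, hb⟩ := h.inn a
  exact ⟨b, (hb b).2 (Or.inl rfl)⟩

/-- The stabiliser of `a` moves some out-neighbour, and there are only two of them, so it
interchanges them. -/
theorem exists_swap_out [Finite G] [N.Normal] (h : IsAltDigraph N R) {a b b' : A}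
    (hb : R a b) (hb' : R a b') : ∃ n ∈ N, n • a = a ∧ n • b = b' := by
  by_cases hne : b = b'
  · exact ⟨1, N.one_mem, by simp, by simpa using hne⟩
  obtain ⟨w, hw, n, hn, hna, hnw⟩ :=
    exists_fixer_moves h.smul_iff h.trans h.conn h.faithful h.nonsemi a
  have hnw' : R a (n • w) := by
    have := (h.smul_iff n a w).2 hw
    rwa [hna] at this
  obtain ⟨c, c', -, hc⟩ := h.out a
  rw [hc] at hb hb' hw hnw'
  by_cases hwb : w = b
  · subst hwb
    exact ⟨n, hn, hna, by grind⟩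
  · refine ⟨n⁻¹, N.inv_mem hn, inv_smul_eq_iff.2 hna.symm, inv_smul_eq_iff.2 ?_⟩
    grind

theorem flip_conn (h : IsAltDigraph N R) (a b : A) : Relation.EqvGen (fun x y => R y x) a b := by
  have := h.conn a b
  induction this with
  | rel x y hxy => exact .symm _ _ (.rel _ _ hxy)
  | refl => exact .refl _
  | symm _ _ _ ih => exact .symm _ _ ih
  | trans _ _ _ _ _ ih1 ih2 => exact .trans _ _ _ ih1 ih2

/-- The axioms are self-dual under reversal of arcs, so facts about out-neighbours transfer to
in-neighbours. -/
theorem flip (h : IsAltDigraph N R) : IsAltDigraph N (fun x y => R y x) where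
  smul_iff g a b := h.smul_iff g b a
  trans := h.trans
  out := h.inn
  inn := h.out
  alt h1 h2 h3 := h.alt h1 h3 h2
  conn := h.flip_conn
  faithful := h.faithful
  nonsemi := h.nonsemi

theorem exists_swap_inn [Finite G] [N.Normal] (h : IsAltDigraph N R) {a b b' : A}
    (hb : R b a) (hb' : R b' a) : ∃ n ∈ N, n • a = a ∧ n • b = b' :=
  h.flip.exists_swap_out hb hb'

/-- Having the same out-neighbours. -/
def twin (R : A → A → Prop) : Setoid A where
  r a b := ∀ c, R a c ↔ R b c
  iseqv := ⟨fun _ _ => Iff.rfl, fun h c => (h c).symm, fun h h' c => (h c).trans (h' c)⟩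

theorem twin_of (h : IsAltDigraph N R) {a a' b : A} (h1 : R a b) (h2 : R a' b) :
    (twin R) a a' := fun _ => ⟨fun h3 => h.alt h1 h2 h3, fun h3 => h.alt h2 h1 h3⟩

theorem mk_eq_of (h : IsAltDigraph N R) {a a' b : A} (h1 : R a b) (h2 : R a' b) :
    (Quotient.mk (twin R) a) = Quotient.mk (twin R) a' := Quotient.sound (h.twin_of h1 h2)

theorem rel_of_mk_eq {a a' b : A} (h1 : Quotient.mk (twin R) a = Quotient.mk (twin R) a')
    (h2 : R a b) : R a' b := (Quotient.exact h1 b).1 h2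

/-- Every twin class has exactly two members. -/
theorem exists_twin (h : IsAltDigraph N R) (a : A) :
    ∃ a', a ≠ a' ∧ ∀ b, Quotient.mk (twin R) b = Quotient.mk (twin R) a ↔ b = a ∨ b = a' := by
  obtain ⟨c, hc⟩ := h.exists_out a
  obtain ⟨x, y, hxy, hin⟩ := h.inn c
  have key : ∀ b, Quotient.mk (twin R) b = Quotient.mk (twin R) a ↔ R b c :=
    fun b => ⟨fun hb => rel_of_mk_eq hb.symm hc, fun hb => h.mk_eq_of hb hc⟩
  simp only [key, hin]
  rcases (hin a).1 hc with rfl | rfl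
  · exact ⟨y, hxy, fun b => Iff.rfl⟩
  · exact ⟨x, hxy.symm, fun b => or_comm⟩

/-- The digraph induced on the twin classes. -/
def twinRel (R : A → A → Prop) (x y : Quotient (twin R)) : Prop :=
  ∃ a b, Quotient.mk (twin R) a = x ∧ Quotient.mk (twin R) b = y ∧ R a b

theorem twin_smul (h : IsAltDigraph N R) (g : G) {a b : A} (hab : (twin R) a b) :
    (twin R) (g • a) (g • b) := fun c => by
  have := hab (g⁻¹ • c)
  rwa [← h.smul_iff g, ← h.smul_iff g b, smul_inv_smul] at this

/-- The action on twin classes. -/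
abbrev twinAction (h : IsAltDigraph N R) : MulAction G (Quotient (twin R)) where
  smul g := Quotient.map (g • ·) fun _ _ hab => h.twin_smul g hab
  one_smul x := by
    induction x using Quotient.inductionOn with
    | h a => exact congrArg (Quotient.mk _) (one_smul G a)
  mul_smul g k x := by
    induction x using Quotient.inductionOn with
    | h a => exact congrArg (Quotient.mk _) (mul_smul g k a)

/-- For an in-neighbour `q` of `a`, the twins `q` and `n • q` make `q` a common in-neighbour of the
twins `a` and `n • a`. This gives faithfulness on twin classes. -/
theorem eq_of_twins (h : IsAltDigraph N R)
    (hnd : ∀ a b, Quotient.mk (twin R) a = Quotient.mk (twin R) b → (∃ c, R c a ∧ R c b) → a = b)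
    (n : G) (hn : ∀ a : A, Quotient.mk (twin R) (n • a) = Quotient.mk (twin R) a) (a : A) :
    n • a = a := by
  obtain ⟨q, hq⟩ := h.exists_inn a
  exact hnd _ _ (hn a) ⟨q, rel_of_mk_eq (hn q) ((h.smul_iff n q a).2 hq), hq⟩

/-- If no two vertices have the same out-neighbours and a common in-neighbour, then the digraph of
twin classes satisfies the same conditions. -/
theorem twinRel_isAltDigraph [Finite G] [N.Normal] (hc : ∀ m ∈ N, ∀ n ∈ N, m * n = n * m)
    (h : IsAltDigraph N R)
    (hnd : ∀ a b, Quotient.mk (twin R) a = Quotient.mk (twin R) b → (∃ c, R c a ∧ R c b) → a = b) :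
    let _ := h.twinAction
    IsAltDigraph N (twinRel R) := by
  let _ := h.twinAction
  have hsm : ∀ (g : G) (a : A), g • (Quotient.mk (twin R) a) = Quotient.mk (twin R) (g • a) :=
    fun _ _ => rfl
  have himp : ∀ (g : G) x y, twinRel R x y → twinRel R (g • x) (g • y) := by
    rintro g x y ⟨a, b, rfl, rfl, hab⟩
    exact ⟨g • a, g • b, rfl, rfl, (h.smul_iff g a b).2 hab⟩
  refine
    { smul_iff := fun g x y => ⟨fun hxy => ?_, himp g x y⟩
      trans := fun x y => ?_
      out := fun x => ?_
      inn := fun x => ?_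
      alt := ?_
      conn := fun x y => ?_
      faithful := fun n hn hfix => ?_
      nonsemi := ?_ }
  · simpa using himp g⁻¹ _ _ hxy
  · obtain ⟨a, rfl⟩ := Quotient.exists_rep x
    obtain ⟨b, rfl⟩ := Quotient.exists_rep y
    obtain ⟨g, rfl⟩ := h.trans a b
    exact ⟨g, rfl⟩
  · obtain ⟨a, rfl⟩ := Quotient.exists_rep x
    obtain ⟨b, b', hbb, hout⟩ := h.out a
    have hb := (hout b).2 (Or.inl rfl)
    have hb' := (hout b').2 (Or.inr rfl)
    refine ⟨Quotient.mk _ b, Quotient.mk _ b', fun heq => hbb (hnd b b' heq ⟨a, hb, hb'⟩), ?_⟩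
    intro y
    constructor
    · rintro ⟨a', c, ha', rfl, hac⟩
      rcases (hout c).1 (rel_of_mk_eq ha' hac) with rfl | rfl
      · exact Or.inl rfl
      · exact Or.inr rfl
    · rintro (rfl | rfl)
      · exact ⟨a, b, rfl, rfl, hb⟩
      · exact ⟨a, b', rfl, rfl, hb'⟩
  · obtain ⟨b, rfl⟩ := Quotient.exists_rep x
    obtain ⟨b', hbb, hcl⟩ := h.exists_twin b
    obtain ⟨a, ha⟩ := h.exists_inn b
    obtain ⟨a', ha'⟩ := h.exists_inn b'
    have hb' := (hcl b').2 (Or.inr rfl)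
    refine ⟨Quotient.mk _ a, Quotient.mk _ a', fun heq => hbb (hnd b b' hb'.symm
      ⟨a', rel_of_mk_eq heq ha, ha'⟩), ?_⟩
    intro y
    constructor
    · rintro ⟨c, d, rfl, hd, hcd⟩
      rcases (hcl d).1 hd with rfl | rfl
      · exact Or.inl (h.mk_eq_of hcd ha)
      · exact Or.inr (h.mk_eq_of hcd ha')
    · rintro (rfl | rfl)
      · exact ⟨a, b, rfl, rfl, ha⟩
      · exact ⟨a', b', rfl, hb', ha'⟩
  · rintro x x' y y' ⟨a, b, rfl, rfl, hab⟩ ⟨a', b₁, rfl, hb₁, hab₁⟩ ⟨a₁, b', ha₁, rfl, hab'⟩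
    replace hab' := rel_of_mk_eq ha₁ hab'
    -- Commutativity enters here. With `n` in `N_a` taking `b` to `b'`, and `m` in `N_c` taking `b`
    -- to its twin `b₁` for a common out-neighbour `c`, one has `m n c = n m c = n c`; so `m n b` is
    -- a twin of `b'`, and it is an out-neighbour of `a'`.
    obtain ⟨n, hn, -, rfl⟩ := h.exists_swap_out hab hab'
    obtain ⟨c, hbc⟩ := h.exists_out b
    obtain ⟨m, hm, hmc, rfl⟩ := h.exists_swap_inn hbc (rel_of_mk_eq hb₁.symm hbc)
    have h1 : R (n • b) (n • c) := (h.smul_iff n b c).2 hbc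
    have h2 : R (m • n • b) (n • c) := by
      have := (h.smul_iff m _ _).2 h1
      rwa [smul_smul m n c, hc m hm n hn, ← smul_smul n m c, hmc] at this
    refine ⟨a', m • n • b, rfl, h.mk_eq_of h2 h1, ?_⟩
    exact h.alt ((h.smul_iff m a b).2 hab) hab₁ ((h.smul_iff m _ _).2 hab')
  · obtain ⟨a, rfl⟩ := Quotient.exists_rep x
    obtain ⟨b, rfl⟩ := Quotient.exists_rep y
    have := h.conn a b
    induction this with
    | rel x y hxy => exact .rel _ _ ⟨x, y, rfl, rfl, hxy⟩
    | refl => exact .refl _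
    | symm _ _ _ ih => exact .symm _ _ ih
    | trans _ _ _ _ _ ih1 ih2 => exact .trans _ _ _ ih1 ih2
  · exact h.faithful n hn (h.eq_of_twins hnd n fun a => hfix (Quotient.mk _ a))
  · obtain ⟨n, hn, hn1, a, ha⟩ := h.nonsemi
    exact ⟨n, hn, hn1, Quotient.mk _ a, by rw [hsm, ha]⟩

end IsAltDigraph

/-! ### Doubled cycles, and recovering a digraph from its quotient -/

/-- A permutation of a finite set with a single cycle is a translation of some `ZMod r`. -/
theorem exists_equiv_zmod_of_transitive {W : Type*} [Finite W] (T : Equiv.Perm W) (w₀ : W)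
    (htr : ∀ w, ∃ k : ℤ, (T ^ k) w₀ = w) :
    ∃ r, 0 < r ∧ ∃ e : W ≃ ZMod r, ∀ w, e (T w) = e w + 1 := by
  let e := MulAction.orbitZPowersEquiv T w₀
  have hmem : ∀ w, w ∈ MulAction.orbit (Subgroup.zpowers T) w₀ := fun w => by
    obtain ⟨k, rfl⟩ := htr w
    exact ⟨⟨T ^ k, k, rfl⟩, rfl⟩
  have he : ∀ k : ℤ, e ⟨(T ^ k) w₀, hmem _⟩ = k := fun k => by
    rw [← Equiv.eq_symm_apply]
    apply Subtype.ext
    have := congrArg Subtype.val (MulAction.orbitZPowersEquiv_symm_apply' T w₀ k)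
    rw [this]
    rfl
  refine ⟨_, ?_, (Equiv.subtypeUnivEquiv hmem).symm.trans e, fun w => ?_⟩
  · exact Function.IsPeriodicPt.minimalPeriod_pos (orderOf_pos T)
      (by
        change T^[orderOf T] w₀ = w₀
        rw [Equiv.Perm.iterate_eq_pow, pow_orderOf_eq_one]
        rfl)
  · obtain ⟨k, rfl⟩ := htr w
    have h1 := he (k + 1)
    have h2 := he k
    rw [zpow_add_one, ← (Commute.refl T).zpow_left k |>.eq.symm] at h1
    simpa [h2] using h1

namespace IsAltDigraph

variable {G : Type*} [Group G] {N : Subgroup G} {A : Type*} [MulAction G A] {R : A → A → Prop}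

/-- An element fixing one member of a two-element twin class preserves the class, hence fixes the
other member. -/
theorem smul_eq_of_mk_eq (h : IsAltDigraph N R) {n : G} {a b : A} (ha : n • a = a)
    (hab : Quotient.mk (twin R) b = Quotient.mk (twin R) a) : n • b = b := by
  obtain ⟨a', haa, hcl⟩ := h.exists_twin a
  rcases (hcl b).1 hab with rfl | rfl
  · exact ha
  · have h1 : Quotient.mk (twin R) (n • b) = Quotient.mk (twin R) a := by
      have := Quotient.sound (h.twin_smul n (Quotient.exact hab))
      rwa [ha] at this
    rcases (hcl _).1 h1 with h2 | h2
    · exact absurd (smul_left_cancel n (ha.trans h2.symm)) haa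
    · exact h2

/-- If two distinct vertices have the same out-neighbours and a common in-neighbour, then the
digraph is a directed cycle with doubled vertices. -/
theorem exists_equiv_of_double (h : IsAltDigraph N R) [Finite A]
    (hd : ∃ a b, a ≠ b ∧ Quotient.mk (twin R) a = Quotient.mk (twin R) b ∧ ∃ c, R c a ∧ R c b) :
    ∃ r, 0 < r ∧ ∃ e : Quotient (twin R) ≃ ZMod r, ∀ a b,
      R a b ↔ e (Quotient.mk _ b) = e (Quotient.mk _ a) + 1 := by
  -- By transitivity the one doubled pair is carried onto every twin pair, so all twins share their
  -- in-neighbours.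
  have hin : ∀ {b b' : A}, Quotient.mk (twin R) b = Quotient.mk (twin R) b' →
      ∀ {c}, R c b → R c b' := by
    intro b b' hbb c hcb
    by_cases hne : b = b'
    · exact hne ▸ hcb
    obtain ⟨x, y, hxy, htw, z, hzx, hzy⟩ := hd
    obtain ⟨g, rfl⟩ := h.trans x b
    obtain ⟨b₁, -, hcl⟩ := h.exists_twin (g • x)
    have h1 := (hcl b').1 hbb.symm
    have h2 := (hcl (g • y)).1 (Quotient.sound (h.twin_smul g (Quotient.exact htw.symm)))
    have h3 : g • y ≠ g • x := fun h4 => hxy (smul_left_cancel g h4).symm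
    have h5 : b' = g • y := by grind
    rw [h5]
    exact h.alt ((h.smul_iff g z x).2 hzx) hcb ((h.smul_iff g z y).2 hzy)
  have hfun : ∀ {a b b' : A}, R a b → R a b' →
      Quotient.mk (twin R) b = Quotient.mk (twin R) b' := by
    intro a b b' hb hb'
    obtain ⟨b₁, hbb, hcl⟩ := h.exists_twin b
    have h1 : R a b₁ := hin ((hcl b₁).2 (Or.inr rfl)).symm hb
    obtain ⟨x, y, hxy, hout⟩ := h.out a
    refine ((hcl b').2 ?_).symm
    rw [hout] at hb hb' h1
    grind
  choose nx hnx using h.exists_out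
  -- The out-neighbours of a vertex form one twin class, so arcs induce a successor map on classes;
  -- connectedness makes it a single cycle.
  let T : Quotient (twin R) → Quotient (twin R) :=
    Quotient.lift (fun a => Quotient.mk (twin R) (nx a))
      (fun a b hab => hfun (hnx a) ((hab _).2 (hnx b)))
  have hT : ∀ {a b}, R a b → T (Quotient.mk _ a) = Quotient.mk _ b := fun {a b} hab =>
    hfun (hnx a) hab
  have hTinj : Function.Injective T := by
    intro x y hxy
    obtain ⟨a, rfl⟩ := Quotient.exists_rep x
    obtain ⟨b, rfl⟩ := Quotient.exists_rep y
    exact h.mk_eq_of (hin hxy (hnx a)) (hnx b)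
  let P : Equiv.Perm (Quotient (twin R)) :=
    Equiv.ofBijective T (Finite.injective_iff_bijective.1 hTinj)
  have hP : ∀ {a b}, R a b → P (Quotient.mk _ a) = Quotient.mk _ b := hT
  obtain ⟨-, -, -, a₀, -⟩ := h.nonsemi
  obtain ⟨r, hr, e, he⟩ := exists_equiv_zmod_of_transitive P (Quotient.mk _ a₀) (by
    intro w
    obtain ⟨b, rfl⟩ := Quotient.exists_rep w
    have := h.conn a₀ b
    clear_value P
    generalize a₀ = a at this
    induction this with
    | rel x y hxy => exact ⟨1, by simpa using hP hxy⟩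
    | refl => exact ⟨0, rfl⟩
    | symm x y _ ih =>
      obtain ⟨k, hk⟩ := ih
      exact ⟨-k, by rw [← hk, ← Equiv.Perm.mul_apply, ← zpow_add]; simp⟩
    | trans x y z _ _ ih1 ih2 =>
      obtain ⟨k, hk⟩ := ih1
      obtain ⟨l, hl⟩ := ih2
      exact ⟨l + k, by rw [zpow_add, Equiv.Perm.mul_apply, hk, hl]⟩)
  refine ⟨r, hr, e, fun a b => ⟨fun hab => by rw [← hP hab, he], fun hab => ?_⟩⟩
  rw [← he, e.apply_eq_iff_eq, hP (hnx a)] at hab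
  exact hin hab.symm (hnx a)

open Classical in
/-- The digraph is the shift digraph on words of length one when it has doubled vertices. -/
theorem exists_equiv_shiftRel_one (h : IsAltDigraph N R) {r : ℕ}
    (e : Quotient (twin R) ≃ ZMod r)
    (he : ∀ a b, R a b ↔ e (Quotient.mk _ b) = e (Quotient.mk _ a) + 1) :
    ∃ φ : A ≃ (Fin 1 → ZMod 2) × ZMod r, ∀ a b, R a b ↔ shiftRel r 1 (φ a) (φ b) := by
  -- The single letter tells the chosen representative of a twin class from the other member.
  let φ : A → (Fin 1 → ZMod 2) × ZMod r := fun a =>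
    (fun _ => if a = (Quotient.mk (twin R) a).out then 0 else 1, e (Quotient.mk _ a))
  have hinj : Function.Injective φ := by
    intro a b hab
    have h1 := congrFun (congrArg Prod.fst hab) 0
    have h2 : Quotient.mk (twin R) a = Quotient.mk (twin R) b :=
      e.injective (congrArg Prod.snd hab)
    obtain ⟨c, hc, hcl⟩ := h.exists_twin (Quotient.mk (twin R) b).out
    simp only [φ, h2] at h1
    simp only [Quotient.out_eq] at hcl
    have h3 := (hcl a).1 h2
    have h4 := (hcl b).1 rfl
    split_ifs at h1 with h5 h6 h6
    · exact h5.trans h6.symm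
    · exact absurd h1 (by decide)
    · exact absurd h1 (by decide)
    · exact (h3.resolve_left h5).trans (h4.resolve_left h6).symm
  have hsurj : Function.Surjective φ := by
    rintro ⟨u, x⟩
    obtain ⟨w, rfl⟩ := e.surjective x
    obtain ⟨c, hc, hcl⟩ := h.exists_twin w.out
    simp only [Quotient.out_eq] at hcl
    by_cases hu : u 0 = 0
    · refine ⟨w.out, Prod.ext (funext fun i => ?_) ?_⟩
      · rw [Subsingleton.elim i 0]
        change _ = u 0
        rw [hu]
        simp [φ]
      · simp [φ]
    · have hc' := (hcl c).2 (Or.inr rfl)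
      refine ⟨c, Prod.ext (funext fun i => ?_) ?_⟩
      · have : u 0 = 1 := by
          generalize u 0 = z at hu
          revert hu; revert z; decide
        rw [Subsingleton.elim i 0]
        change _ = u 0
        rw [this]
        simp only [φ, hc']
        rw [if_neg hc.symm]
      · simp [φ, hc']
  refine ⟨Equiv.ofBijective φ ⟨hinj, hsurj⟩, fun a b => ?_⟩
  rw [he]
  refine ⟨fun h1 => ⟨h1, fun i j hij => ?_⟩, fun h1 => h1.1⟩
  omega

/-- A vertex is recovered from its twin class and the twin class of its in-neighbours. -/
theorem exists_equiv_shiftRel_succ (h : IsAltDigraph N R)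
    (hnd : ∀ a b, Quotient.mk (twin R) a = Quotient.mk (twin R) b → (∃ c, R c a ∧ R c b) → a = b)
    {r s : ℕ} (hs : 1 ≤ s) (φ : Quotient (twin R) ≃ (Fin s → ZMod 2) × ZMod r)
    (hφ : ∀ x y, twinRel R x y ↔ shiftRel r s (φ x) (φ y)) :
    ∃ ψ : A ≃ (Fin (s + 1) → ZMod 2) × ZMod r,
      ∀ a b, R a b ↔ shiftRel r (s + 1) (ψ a) (ψ b) := by
  choose pr hpr using h.exists_inn
  have hst : ∀ a, shiftRel r s (φ (Quotient.mk _ (pr a))) (φ (Quotient.mk _ a)) := fun a =>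
    (hφ _ _).1 ⟨_, _, rfl, rfl, hpr a⟩
  -- A vertex is read as the arc from the class of its in-neighbours to its own class. The two words
  -- overlap in `s - 1` letters and together spell `s + 1` letters, placed on the layer of the tail.
  let ψ : A → (Fin (s + 1) → ZMod 2) × ZMod r := fun a =>
    (Fin.cons ((φ (Quotient.mk _ (pr a))).1 ⟨0, hs⟩) (φ (Quotient.mk _ a)).1,
      (φ (Quotient.mk _ (pr a))).2)
  have hpre : ∀ a b, (φ (Quotient.mk _ (pr a))).2 = (φ (Quotient.mk _ (pr b))).2 →
      (∀ i : Fin s, (ψ a).1 i.castSucc = (ψ b).1 i.castSucc) →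
      Quotient.mk (twin R) (pr a) = Quotient.mk (twin R) (pr b) := by
    intro a b h2 h1
    refine φ.injective (Prod.ext (funext fun i => ?_) h2)
    have h3 := h1 i
    obtain ⟨i, hi⟩ := i
    cases i with
    | zero => exact h3
    | succ j =>
      rw [(hst a).2 ⟨j + 1, hi⟩ ⟨j, by omega⟩ rfl, (hst b).2 ⟨j + 1, hi⟩ ⟨j, by omega⟩ rfl]
      exact h3
  have hinj : Function.Injective ψ := by
    intro a b hab
    have h2 : (ψ a).2 = (ψ b).2 := congrArg Prod.snd hab
    change (φ (Quotient.mk _ (pr a))).2 = (φ (Quotient.mk _ (pr b))).2 at h2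
    have h1 : (ψ a).1 = (ψ b).1 := congrArg Prod.fst hab
    have h3 := hpre a b h2 fun i => by rw [h1]
    have h4 : Quotient.mk (twin R) a = Quotient.mk (twin R) b := by
      refine φ.injective (Prod.ext (funext fun i => ?_) ?_)
      · exact congrFun h1 i.succ
      · rw [(hst a).1, (hst b).1, h2]
    exact hnd a b h4 ⟨pr a, hpr a, rel_of_mk_eq h3.symm (hpr b)⟩
  have hsurj : Function.Surjective ψ := by
    rintro ⟨u, x⟩
    obtain ⟨c, hc⟩ := φ.surjective (fun i => u i.castSucc, x)
    obtain ⟨d, hd⟩ := φ.surjective (fun i => u i.succ, x + 1)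
    have hcd : twinRel R c d := by
      rw [hφ, hc, hd]
      refine ⟨rfl, fun i j hij => congrArg u (Fin.ext ?_)⟩
      simpa using hij
    obtain ⟨p, a, rfl, rfl, hpa⟩ := hcd
    have hpp := h.mk_eq_of (hpr a) hpa
    refine ⟨a, Prod.ext (funext fun i => ?_) ?_⟩
    · simp only [ψ, hpp, hc, hd]
      refine Fin.cases ?_ (fun i => ?_) i <;> simp
    · simp only [ψ, hpp, hc]
  refine ⟨Equiv.ofBijective ψ ⟨hinj, hsurj⟩, fun a b => ?_⟩
  have hab : R a b ↔ Quotient.mk (twin R) (pr b) = Quotient.mk (twin R) a :=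
    ⟨fun h1 => h.mk_eq_of (hpr b) h1, fun h1 => rel_of_mk_eq h1 (hpr b)⟩
  rw [hab, ← φ.apply_eq_iff_eq]
  constructor
  · intro h1
    refine ⟨?_, fun i j hij => ?_⟩
    · change (φ (Quotient.mk _ (pr b))).2 = (φ (Quotient.mk _ (pr a))).2 + 1
      rw [h1, (hst a).1]
    · obtain ⟨i, hi⟩ := i
      obtain ⟨j, hj⟩ := j
      obtain rfl : i = j + 1 := hij
      change (φ (Quotient.mk _ a)).1 ⟨j, by omega⟩ = _
      rw [← h1]
      cases j with
      | zero => rfl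
      | succ j => exact (hst b).2 ⟨j + 1, by omega⟩ ⟨j, by omega⟩ rfl
  · rintro ⟨h1, h2⟩
    change (φ (Quotient.mk _ (pr b))).2 = (φ (Quotient.mk _ (pr a))).2 + 1 at h1
    refine Prod.ext (funext fun i => ?_) (by rw [h1, (hst a).1])
    have h3 := h2 i.succ i.castSucc rfl
    change (φ (Quotient.mk _ a)).1 i = _ at h3
    rw [h3]
    obtain ⟨i, hi⟩ := i
    cases i with
    | zero => rfl
    | succ j => exact (hst b).2 ⟨j + 1, by omega⟩ ⟨j, by omega⟩ rfl

end IsAltDigraph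

/-! ### Classification of alternating digraphs -/

/-- A connected alternating digraph of valency two with a normal abelian group of automorphisms
that is not semiregular is a shift digraph, and the length of the words is bounded in terms of
the length of any walk fixed by a nontrivial element. -/
theorem IsAltDigraph.exists_equiv_shiftRel {G : Type*} [Group G] [Finite G] {N : Subgroup G}
    [N.Normal] (hc : ∀ m ∈ N, ∀ n ∈ N, m * n = n * m) {A : Type*} [Finite A] [MulAction G A]
    {R : A → A → Prop} (h : IsAltDigraph N R) :
    ∃ r s, 1 ≤ s ∧ (∃ φ : A ≃ (Fin s → ZMod 2) × ZMod r, ∀ a b,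
      R a b ↔ shiftRel r s (φ a) (φ b)) ∧
      ∀ n ∈ N, n ≠ 1 → ∀ (k : ℕ) (p : ℕ → A), (∀ i < k, R (p i) (p (i + 1))) →
        (∀ i ≤ k, n • p i = p i) → s + k + 1 ≤ r := by
  induction hm : Nat.card A using Nat.strong_induction_on generalizing A with
  | _ m ih =>
  by_cases hd : ∃ a b, a ≠ b ∧ Quotient.mk (twin R) a = Quotient.mk (twin R) b ∧ ∃ c, R c a ∧ R c b
  · obtain ⟨r, hr, e, he⟩ := h.exists_equiv_of_double hd
    refine ⟨r, 1, le_rfl, h.exists_equiv_shiftRel_one e he, ?_⟩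
    intro n hn hn1 k p hp hfix
    -- If `r ≤ k + 1`, the fixed walk meets all `r` layers, and each layer is one twin class, so `n`
    -- fixes every vertex.
    by_contra! hlt
    refine hn1 (h.faithful n hn fun a => ?_)
    have hlay : ∀ i ≤ k, e (Quotient.mk _ (p i)) = e (Quotient.mk _ (p 0)) + i := by
      intro i hi
      induction i with
      | zero => simp
      | succ i ih => rw [(he _ _).1 (hp i (by omega)), ih (by omega)]; push_cast; ring
    have : NeZero r := ⟨hr.ne'⟩
    let z := e (Quotient.mk _ a) - e (Quotient.mk _ (p 0))
    have hz : z.val ≤ k := by have := z.val_lt; omega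
    refine h.smul_eq_of_mk_eq (hfix z.val hz) (e.injective ?_)
    rw [hlay z.val hz, ZMod.natCast_zmod_val]
    simp [z]
  · have hnd : ∀ a b, Quotient.mk (twin R) a = Quotient.mk (twin R) b →
        (∃ c, R c a ∧ R c b) → a = b := by
      intro a b h1 h2
      by_contra hne
      exact hd ⟨a, b, hne, h1, h2⟩
    let _ := h.twinAction
    have h' : IsAltDigraph N (twinRel R) := h.twinRel_isAltDigraph hc hnd
    have hcard : Nat.card (Quotient (twin R)) < m := by
      subst hm
      have := Fintype.ofFinite A
      have := Fintype.ofFinite (Quotient (twin R))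
      rw [Nat.card_eq_fintype_card, Nat.card_eq_fintype_card]
      refine Fintype.card_lt_of_surjective_not_injective (Quotient.mk (twin R))
        Quotient.mk_surjective fun hinj => ?_
      obtain ⟨-, -, -, a, -⟩ := h.nonsemi
      obtain ⟨b, hab, hcl⟩ := h.exists_twin a
      exact hab (hinj ((hcl b).2 (Or.inr rfl))).symm
    obtain ⟨r, s, hs, ⟨φ, hφ⟩, hwalk⟩ := ih _ hcard h' rfl
    refine ⟨r, s + 1, by omega, h.exists_equiv_shiftRel_succ hnd hs φ hφ, ?_⟩
    intro n hn hn1 k p hp hfix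
    -- `n` may move `q`, but only to another in-neighbour of `p 0`, so it fixes the class of `q`.
    -- The fixed walk in the quotient thus has length `k + 1`, which offsets the word being one
    -- letter shorter there.
    obtain ⟨q, hq⟩ := h.exists_inn (p 0)
    have := hwalk n hn hn1 (k + 1)
      (fun i => Quotient.mk _ (match i with | 0 => q | i + 1 => p i)) ?_ ?_
    · omega
    · rintro (_ | i) hi
      · exact ⟨q, p 0, rfl, rfl, hq⟩
      · exact ⟨p i, p (i + 1), rfl, rfl, hp i (by omega)⟩
    · rintro (_ | i) hi
      · change Quotient.mk _ (n • q) = Quotient.mk (twin R) q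
        refine h.mk_eq_of (b := p 0) ?_ hq
        rw [← hfix 0 (by omega), h.smul_iff]
        exact hq
      · exact congrArg (Quotient.mk _) (hfix i (by omega))

/-! ### Split graphs of digraphs -/

/-- The graph obtained from a digraph by splitting every vertex into an in-end `(a, false)` and an
out-end `(a, true)`. -/
def digraphSplit {A : Type*} (R : A → A → Prop) : SimpleGraph (A × Bool) where
  Adj p q := (p.1 = q.1 ∧ p.2 ≠ q.2) ∨ (p.2 = true ∧ q.2 = false ∧ R p.1 q.1) ∨
    (p.2 = false ∧ q.2 = true ∧ R q.1 p.1)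
  symm := ⟨by
    rintro p q (⟨h, h'⟩ | ⟨h, h', h''⟩ | ⟨h, h', h''⟩)
    · exact Or.inl ⟨h.symm, h'.symm⟩
    · exact Or.inr (Or.inr ⟨h', h, h''⟩)
    · exact Or.inr (Or.inl ⟨h', h, h''⟩)⟩
  loopless := ⟨by
    rintro p (⟨h, h'⟩ | ⟨h, h', h''⟩ | ⟨h, h', h''⟩)
    · exact h' rfl
    · simp_all
    · simp_all⟩

/-- Isomorphic digraphs have isomorphic split graphs. -/
def digraphSplitIso {A B : Type*} {R : A → A → Prop} {S : B → B → Prop} (φ : A ≃ B)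
    (hφ : ∀ a b, R a b ↔ S (φ a) (φ b)) : digraphSplit R ≃g digraphSplit S where
  toEquiv := φ.prodCongr (Equiv.refl Bool)
  map_rel_iff' {p q} := by
    simp [digraphSplit, hφ]

/-! ### A two-colouring from a dihedral action -/

/-- Two fixed-point-free involutions generating a transitive group admit a two-colouring that
both of them reverse. -/
theorem exists_coloring_of_involutions {X : Type*} (F S : Equiv.Perm X) (hF : F * F = 1)
    (hS : S * S = 1) (hF0 : ∀ x, F x ≠ x) (hS0 : ∀ x, S x ≠ x) (x₀ : X)
    (hgen : ∀ P : X → Prop, P x₀ → (∀ x, P x → P (F x)) → (∀ x, P x → P (S x)) → ∀ x, P x) :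
    ∃ c : X → Prop, (∀ x, c (F x) ↔ ¬ c x) ∧ ∀ x, c (S x) ↔ ¬ c x := by
  have hFF : ∀ x, F (F x) = x := fun x => by rw [← Equiv.Perm.mul_apply, hF]; rfl
  have hSS : ∀ x, S (S x) = x := fun x => by rw [← Equiv.Perm.mul_apply, hS]; rfl
  obtain ⟨T, hT⟩ : ∃ T, T = F * S := ⟨_, rfl⟩
  have hTx : ∀ x, T x = F (S x) := fun x => by rw [hT]; rfl
  have hFT : ∀ (k : ℤ) x, F ((T ^ k) x) = (T ^ (-k)) (F x) := fun k x => by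
    have h1 : F * T * F⁻¹ = T⁻¹ := by
      rw [inv_eq_of_mul_eq_one_left hF, hT, mul_inv_rev, inv_eq_of_mul_eq_one_left hF,
        inv_eq_of_mul_eq_one_left hS, ← mul_assoc, hF, one_mul]
    have h2 : F * T ^ k = T ^ (-k) * F := by
      rw [← mul_inv_eq_iff_eq_mul, ← conj_zpow, h1, inv_zpow']
    exact congrArg (· x) h2
  have hadd : ∀ (k l : ℤ) x, (T ^ (k + l)) x = (T ^ k) ((T ^ l) x) := fun k l x => by
    rw [zpow_add]; rfl
  -- Reflections of the dihedral group are conjugate to `F` or `S`: according to the parity of `k`,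
  -- the point `T ^ j y` would be fixed by `F` or by `S`.
  have hodd : ∀ (k : ℤ) y, F y ≠ (T ^ k) y := by
    intro k y hk
    obtain ⟨j, rfl | rfl⟩ := k.even_or_odd'
    · refine hF0 ((T ^ j) y) ?_
      rw [hFT, hk, ← hadd]
      congr 2
      ring
    · refine hS0 ((T ^ j) y) (F.injective ?_)
      rw [← hTx, hFT, hk, ← hadd]
      change (T * T ^ j) y = _
      rw [← zpow_one_add]
      congr 2
      ring
  -- The colour class is the orbit of `x₀` under the rotations; `F` carries it to its complement.
  let c : X → Prop := fun x => ∃ k : ℤ, (T ^ k) x₀ = x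
  have hone : ∀ x, c x → ¬ c (F x) := by
    rintro x ⟨k, rfl⟩ ⟨l, hl⟩
    refine hodd (k + l) x₀ ?_
    rw [hadd, hl, hFT, ← hadd]
    simp
  have hcT : ∀ x, c x → c (T x) := by
    rintro x ⟨k, rfl⟩
    exact ⟨1 + k, by rw [hadd, zpow_one]⟩
  have hcT' : ∀ x, c (T x) → c x := by
    rintro x ⟨k, hk⟩
    exact ⟨-1 + k, by rw [hadd, hk, zpow_neg_one]; exact T.symm_apply_apply x⟩
  have htwo : ∀ x, c x ∨ c (F x) := by
    refine hgen _ (Or.inl ⟨0, rfl⟩) (fun x hx => ?_) (fun x hx => ?_)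
    · rw [hFF]; exact hx.symm
    · refine hx.symm.imp (fun h => hcT' _ ?_) (fun h => hTx x ▸ hcT x h)
      rwa [hTx, hSS]
  have hcF : ∀ x, c (F x) ↔ ¬ c x := fun x =>
    ⟨fun h1 h2 => hone x h2 h1, fun h1 => (htwo x).resolve_left h1⟩
  refine ⟨c, hcF, fun x => ?_⟩
  have h1 := hcF (S x)
  rw [← hTx] at h1
  exact ⟨fun h2 h3 => h1.1 (hcT x h3) h2,
    fun h2 => Classical.not_not.1 fun h3 => h2 (hcT' x (h1.2 h3))⟩

/-! ### Cubic graphs: `K₃₃`, the invariant matching, `K₄` and bipartiteness -/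

section Graph

variable {V : Type*} {Γ : SimpleGraph V}

theorem SimpleGraph.Connected.forall_of_closed (hconn : Γ.Connected) {P : V → Prop} {v₀ : V}
    (h₀ : P v₀) (hP : ∀ v w, Γ.Adj v w → P v → P w) (v : V) : P v := by
  obtain ⟨p⟩ := hconn.preconnected v₀ v
  induction p with
  | nil => exact h₀
  | cons hadj _ ih => exact ih (hP _ _ hadj h₀)

theorem SimpleGraph.Connected.eqvGen_adj (hconn : Γ.Connected) (u v : V) :
    Relation.EqvGen Γ.Adj u v :=
  hconn.forall_of_closed (P := fun v => Relation.EqvGen Γ.Adj u v) (.refl u)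
    (fun _ _ hadj h => .trans _ _ _ h (.rel _ _ hadj)) v

theorem SimpleGraph.Connected.nonempty_iso_completeGraph (hconn : Γ.Connected) {n : ℕ}
    (x : Fin (n + 1) → V) (hx : Function.Injective x)
    (hadj : ∀ i w, Γ.Adj (x i) w ↔ ∃ j, i ≠ j ∧ w = x j) :
    Nonempty (Γ ≃g SimpleGraph.completeGraph (Fin (n + 1))) := by
  have hsurj : Function.Surjective x := by
    refine hconn.forall_of_closed ⟨0, rfl⟩ ?_
    rintro _ w h ⟨i, rfl⟩
    obtain ⟨j, -, rfl⟩ := (hadj i w).1 h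
    exact ⟨j, rfl⟩
  refine ⟨RelIso.symm ⟨Equiv.ofBijective x ⟨hx, hsurj⟩, fun {i j} => ?_⟩⟩
  change Γ.Adj (x i) (x j) ↔ i ≠ j
  rw [hadj]
  refine ⟨?_, fun h => ⟨j, h, rfl⟩⟩
  rintro ⟨k, hk, h⟩
  rwa [hx h]

theorem SimpleGraph.Connected.nonempty_iso_completeBipartiteGraph (hconn : Γ.Connected) {m n : ℕ}
    (x : Fin (m + 1) → V) (y : Fin n → V) (hx : Function.Injective x) (hy : Function.Injective y)
    (hxa : ∀ i w, Γ.Adj (x i) w ↔ ∃ j, w = y j) (hya : ∀ i w, Γ.Adj (y i) w ↔ ∃ j, w = x j) :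
    Nonempty (Γ ≃g completeBipartiteGraph (Fin (m + 1)) (Fin n)) := by
  have hne : ∀ i j, x i ≠ y j := fun i j h => by
    have h1 : Γ.Adj (x i) (y j) := (hxa i _).2 ⟨j, rfl⟩
    exact h1.ne h
  have hsurj : Function.Surjective (Sum.elim x y) := by
    refine hconn.forall_of_closed (v₀ := x 0) ⟨Sum.inl 0, rfl⟩ ?_
    rintro _ w h ⟨i | i, rfl⟩
    · obtain ⟨j, rfl⟩ := (hxa i w).1 h
      exact ⟨Sum.inr j, rfl⟩
    · obtain ⟨j, rfl⟩ := (hya i w).1 h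
      exact ⟨Sum.inl j, rfl⟩
  refine ⟨RelIso.symm ⟨Equiv.ofBijective (Sum.elim x y) ⟨hx.sumElim hy hne, hsurj⟩,
    fun {i j} => ?_⟩⟩
  rcases i with i | i <;> rcases j with j | j
  · change Γ.Adj (x i) (x j) ↔ _
    simp [hxa, hne]
  · change Γ.Adj (x i) (y j) ↔ _
    simp [hxa]
  · change Γ.Adj (y i) (x j) ↔ _
    simp [hya]
  · change Γ.Adj (y i) (y j) ↔ _
    simp [hya, (hne _ _).symm]

/-- Adjacency along the edges outside the matching `f`. -/
def offMatching (Γ : SimpleGraph V) (f : V → V) (v w : V) : Prop := Γ.Adj v w ∧ w ≠ f v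

variable {G : Type*} [Group G] [MulAction G V]

/-- A cubic graph with an invariant perfect matching `f` whose remaining edges form
four-cycles, and a vertex-transitive group `G` such that `N` interchanges opposite vertices. -/
structure IsMatchedCubic (Γ : SimpleGraph V) (N : Subgroup G) (f : V → V) : Prop where
  adj_iff : ∀ (g : G) (a b : V), Γ.Adj (g • a) (g • b) ↔ Γ.Adj a b
  trans : ∀ a b : V, ∃ g : G, g • a = b
  adj_f : ∀ v, Γ.Adj v (f v)
  f_f : ∀ v, f (f v) = v
  f_smul : ∀ (g : G) v, f (g • v) = g • f v
  fixer_f : ∀ v, fixer N (f v) = fixer N v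
  off : ∀ v, ∃ a b, a ≠ b ∧ ∀ w, offMatching Γ f v w ↔ w = a ∨ w = b
  swap : ∀ {v a b}, offMatching Γ f v a → offMatching Γ f v b →
    ∃ n ∈ N, n • v = v ∧ n • a = b
  alt : ∀ {v w a b}, offMatching Γ f v a → offMatching Γ f w a → offMatching Γ f v b →
    offMatching Γ f w b

/-- Either the nontrivial action of point stabilisers in `N` on neighbours is always transitive,
and the graph is `K₃₃`, or it fixes a unique neighbour of every vertex. -/
theorem nonempty_iso_or_isMatchedCubic [Finite G] {N : Subgroup G} [hN : N.Normal]
    (hc : ∀ m ∈ N, ∀ n ∈ N, m * n = n * m) (hconn : Γ.Connected)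
    (hcub : ∀ v, ∃ a b c, a ≠ b ∧ a ≠ c ∧ b ≠ c ∧ ∀ w, Γ.Adj v w ↔ w = a ∨ w = b ∨ w = c)
    (hadj : ∀ (g : G) (a b : V), Γ.Adj (g • a) (g • b) ↔ Γ.Adj a b)
    (htrans : ∀ a b : V, ∃ g : G, g • a = b)
    (hfaith : ∀ n ∈ N, (∀ v : V, n • v = v) → n = 1)
    (hns : ∃ n ∈ N, n ≠ 1 ∧ ∃ v : V, n • v = v) :
    Nonempty (Γ ≃g completeBipartiteGraph (Fin 3) (Fin 3)) ∨ ∃ f, IsMatchedCubic Γ N f := by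
  have hstab : ∀ {n : G} {v w : V}, n • v = v → Γ.Adj v w → Γ.Adj v (n • w) := by
    intro n v w hn hvw
    have := (hadj n v w).2 hvw
    rwa [hn] at this
  by_cases hA : ∀ v w, Γ.Adj v w → ∃ n ∈ N, n • v = v ∧ n • w ≠ w
  · left
    -- A permutation group on three points without a fixed point is transitive.
    have htr : ∀ {v w w'}, Γ.Adj v w → Γ.Adj v w' → ∃ n ∈ N, n • v = v ∧ n • w = w' := by
      intro v
      let S : V → V → Prop := fun w w' => ∃ n ∈ N, n • v = v ∧ n • w = w'
      have hrefl : ∀ w, S w w := fun w => ⟨1, N.one_mem, by simp, by simp⟩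
      have hsymm : ∀ {w w'}, S w w' → S w' w := by
        rintro w _ ⟨n, hn, hv, rfl⟩
        exact ⟨n⁻¹, N.inv_mem hn, inv_smul_eq_iff.2 hv.symm, by simp⟩
      have htrs : ∀ {w w' w''}, S w w' → S w' w'' → S w w'' := by
        rintro w _ _ ⟨n, hn, hv, rfl⟩ ⟨m, hm, hv', rfl⟩
        exact ⟨m * n, N.mul_mem hm hn, by rw [mul_smul, hv, hv'], by rw [mul_smul]⟩
      have hmove : ∀ w, Γ.Adj v w → ∃ w', Γ.Adj v w' ∧ w' ≠ w ∧ S w w' := by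
        intro w hw
        obtain ⟨n, hn, hv, hnw⟩ := hA v w hw
        exact ⟨n • w, hstab hv hw, hnw, n, hn, hv, rfl⟩
      obtain ⟨a, b, c, hab, hac, hbc, hnb⟩ := hcub v
      have ha : S a b ∨ S a c := by
        obtain ⟨w, hw, hne, hS⟩ := hmove a ((hnb a).2 (by simp))
        rcases (hnb w).1 hw with rfl | rfl | rfl
        exacts [absurd rfl hne, Or.inl hS, Or.inr hS]
      have hb : S a b ∨ S b c := by
        obtain ⟨w, hw, hne, hS⟩ := hmove b ((hnb b).2 (by simp))
        rcases (hnb w).1 hw with rfl | rfl | rfl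
        exacts [Or.inl (hsymm hS), absurd rfl hne, Or.inr hS]
      have hab' : S a b ∧ S b c ∧ S a c := by
        obtain ⟨w, hw, hne, hS⟩ := hmove c ((hnb c).2 (by simp))
        have hcc : S a c ∨ S b c := by
          rcases (hnb w).1 hw with rfl | rfl | rfl
          exacts [Or.inl (hsymm hS), Or.inr (hsymm hS), absurd rfl hne]
        by_cases h1 : S a b
        · rcases hcc with h2 | h2
          · exact ⟨h1, htrs (hsymm h1) h2, h2⟩
          · exact ⟨h1, h2, htrs h1 h2⟩
        · have h2 := ha.resolve_left h1
          have h3 := hb.resolve_left h1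
          exact ⟨htrs h2 (hsymm h3), h3, h2⟩
      obtain ⟨h1, h2, h3⟩ := hab'
      intro w w' hw hw'
      change S w w'
      rcases (hnb w).1 hw with rfl | rfl | rfl <;> rcases (hnb w').1 hw' with rfl | rfl | rfl
      exacts [hrefl _, h1, h3, hsymm h1, hrefl _, h2, hsymm h3, hsymm h2, hrefl _]
    have hsame : ∀ {v w w' u}, Γ.Adj v w → Γ.Adj v w' → Γ.Adj w u → Γ.Adj w' u := by
      intro v w w' u hw hw' hu
      -- Since `u = m • v` and `n` fixes `v`, commutativity shows that `n` fixes `u`; hence `n`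
      -- carries the edge `w u` to `w' u`.
      obtain ⟨n, hn, hv, rfl⟩ := htr hw hw'
      obtain ⟨m, hm, hmw, rfl⟩ := htr hw.symm hu
      have h1 : n • m • v = m • v := by rw [smul_smul, hc n hn m hm, ← smul_smul, hv]
      rw [← h1, hadj]
      exact hu
    obtain ⟨v⟩ := hconn.nonempty
    have hvec : ∀ v, ∃ y : Fin 3 → V, Function.Injective y ∧ ∀ w, Γ.Adj v w ↔ ∃ j, w = y j := by
      intro v
      obtain ⟨a, b, c, hab, hac, hbc, hnb⟩ := hcub v
      refine ⟨![a, b, c], ?_, fun w => by simp [hnb, Fin.exists_fin_succ]⟩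
      intro i j hij
      fin_cases i <;> fin_cases j <;> simp_all
    obtain ⟨y, hy, hvy⟩ := hvec v
    have hv0 : Γ.Adj v (y 0) := (hvy _).2 ⟨0, rfl⟩
    obtain ⟨x, hx, hyx⟩ := hvec (y 0)
    refine hconn.nonempty_iso_completeBipartiteGraph x y hx hy (fun i w => ?_) fun i w => ?_
    · have h1 : Γ.Adj (y 0) (x i) := (hyx _).2 ⟨i, rfl⟩
      rw [← hvy]
      exact ⟨hsame h1 hv0.symm, hsame hv0.symm h1⟩
    · have h1 : Γ.Adj v (y i) := (hvy _).2 ⟨i, rfl⟩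
      rw [← hyx]
      exact ⟨hsame h1 hv0, hsame hv0 h1⟩
  · right
    push Not at hA
    obtain ⟨v₀, w₀, hvw₀, hfix₀⟩ := hA
    have hex : ∀ v, ∃ w, Γ.Adj v w ∧ ∀ n ∈ N, n • v = v → n • w = w := by
      intro v
      obtain ⟨g, rfl⟩ := htrans v₀ v
      refine ⟨g • w₀, (hadj g _ _).2 hvw₀, fun n hn hv => ?_⟩
      have h1 := hfix₀ (g⁻¹ * n * g) (by simpa using hN.conj_mem n hn g⁻¹)
        (by rw [mul_smul, mul_smul, hv, inv_smul_smul])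
      rwa [mul_smul, mul_smul, inv_smul_eq_iff] at h1
    choose f hf hffix using hex
    have hmove := exists_fixer_moves hadj htrans hconn.eqvGen_adj hfaith hns
    -- A permutation of three neighbours fixing two of them fixes the third, yet the stabiliser
    -- moves some neighbour.
    have huniq : ∀ v w, Γ.Adj v w → (∀ n ∈ N, n • v = v → n • w = w) → w = f v := by
      intro v w hw hwfix
      by_contra hne
      obtain ⟨u, hu, n, hn, hv, hnu⟩ := hmove v
      have h1 := hwfix n hn hv
      have h2 := hffix v n hn hv
      have h3 : n • u ≠ w := fun h => hnu (by rw [h]; exact smul_left_cancel n (h1.trans h.symm))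
      have h4 : n • u ≠ f v := fun h =>
        hnu (by rw [h]; exact smul_left_cancel n (h2.trans h.symm))
      obtain ⟨a, b, c, hab, hac, hbc, hnb⟩ := hcub v
      have h5 := hf v
      have h6 := hstab hv hu
      rw [hnb] at hw hu h5 h6
      grind
    have hfixer : ∀ v, fixer N (f v) = fixer N v := fun v =>
      (fixer_eq_of_le htrans fun n hn => mem_fixer.2
        ⟨(mem_fixer.1 hn).1, hffix v n (mem_fixer.1 hn).1 (mem_fixer.1 hn).2⟩).symm
    have hff : ∀ v, f (f v) = v := by
      intro v
      refine (huniq _ _ (hf v).symm fun n hn hv => ?_).symm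
      have : n ∈ fixer N (f v) := mem_fixer.2 ⟨hn, hv⟩
      rw [hfixer] at this
      exact (mem_fixer.1 this).2
    have hfsmul : ∀ (g : G) v, f (g • v) = g • f v := by
      intro g v
      refine (huniq _ _ ((hadj g _ _).2 (hf v)) fun n hn hv => ?_).symm
      have h1 := hffix v (g⁻¹ * n * g) (by simpa using hN.conj_mem n hn g⁻¹)
        (by rw [mul_smul, mul_smul, hv, inv_smul_smul])
      rwa [mul_smul, mul_smul, inv_smul_eq_iff] at h1
    have hoff : ∀ v, ∃ a b, a ≠ b ∧ ∀ w, offMatching Γ f v w ↔ w = a ∨ w = b := by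
      intro v
      obtain ⟨a, b, c, hab, hac, hbc, hnb⟩ := hcub v
      unfold offMatching
      have hfv := hf v
      simp only [hnb] at hfv ⊢
      rcases hfv with h | h | h <;> rw [h]
      · exact ⟨b, c, hbc, fun w => by grind⟩
      · exact ⟨a, c, hac, fun w => by grind⟩
      · exact ⟨a, b, hab, fun w => by grind⟩
    have hosmul : ∀ (g : G) v w, offMatching Γ f (g • v) (g • w) ↔ offMatching Γ f v w := by
      intro g v w
      simp [offMatching, hadj, hfsmul]
    have hsymm : ∀ {v w}, offMatching Γ f v w → offMatching Γ f w v := fun {v w} h =>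
      ⟨h.1.symm, fun h1 => h.2 (by rw [h1, hff])⟩
    have hswap : ∀ {v a b}, offMatching Γ f v a → offMatching Γ f v b →
        ∃ n ∈ N, n • v = v ∧ n • a = b := by
      intro v a b ha hb
      by_cases hne : a = b
      · exact ⟨1, N.one_mem, by simp, by simpa using hne⟩
      obtain ⟨w, hw, n, hn, hv, hnw⟩ := hmove v
      have hw1 : offMatching Γ f v w := ⟨hw, fun h => hnw (h ▸ hffix v n hn hv)⟩
      have hw2 : offMatching Γ f v (n • w) := by
        have := (hosmul n v w).2 hw1
        rwa [hv] at this
      obtain ⟨c, d, -, hcd⟩ := hoff v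
      rw [hcd] at ha hb hw1 hw2
      by_cases hwa : w = a
      · subst hwa
        exact ⟨n, hn, hv, by grind⟩
      · refine ⟨n⁻¹, N.inv_mem hn, inv_smul_eq_iff.2 hv.symm, inv_smul_eq_iff.2 ?_⟩
        grind
    refine ⟨f, hadj, htrans, hf, hff, hfsmul, hfixer, hoff, hswap, ?_⟩
    intro v w a b hva hwa hvb
    -- `b = m • a` lies in the `N`-orbit of `a`, so `n`, which fixes `a`, also fixes `b` and carries
    -- the edge `v b` to `w b`.
    obtain ⟨n, hn, hna, rfl⟩ := hswap (hsymm hva) (hsymm hwa)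
    obtain ⟨m, hm, hmv, rfl⟩ := hswap hva hvb
    have h1 : n ∈ fixer N (m • a) := by
      rw [fixer_smul_of_comm hc hm]; exact mem_fixer.2 ⟨hn, hna⟩
    rw [← (mem_fixer.1 h1).2, hosmul]
    exact hvb

namespace IsMatchedCubic

variable {N : Subgroup G} {f : V → V}

theorem off_smul (h : IsMatchedCubic Γ N f) (g : G) (v w : V) :
    offMatching Γ f (g • v) (g • w) ↔ offMatching Γ f v w := by
  simp [offMatching, h.adj_iff, h.f_smul]

theorem off_symm (h : IsMatchedCubic Γ N f) {v w : V} (hvw : offMatching Γ f v w) :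
    offMatching Γ f w v :=
  ⟨hvw.1.symm, fun h1 => hvw.2 (by rw [h1, h.f_f])⟩

theorem adj_cases (h : IsMatchedCubic Γ N f) (v w : V) :
    Γ.Adj v w ↔ w = f v ∨ offMatching Γ f v w := by
  by_cases hw : w = f v
  · simp [hw, h.adj_f]
  · simp [hw, offMatching]

theorem exists_off (h : IsMatchedCubic Γ N f) (v : V) : ∃ w, offMatching Γ f v w := by
  obtain ⟨a, b, -, hab⟩ := h.off v
  exact ⟨a, (hab a).2 (Or.inl rfl)⟩

/-- `v` and `f v` have the same two off-matching neighbours `a`, `b`. By transitivity `a` and `f a`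
also share one, which is `v` or `f v`; this forces `f a = b` and closes up the four vertices. -/
theorem nonempty_iso_completeGraph (h : IsMatchedCubic Γ N f) (hconn : Γ.Connected) {v a : V}
    (hv : offMatching Γ f v a) (hfv : offMatching Γ f (f v) a) :
    Nonempty (Γ ≃g SimpleGraph.completeGraph (Fin 4)) := by
  obtain ⟨b, hab, hoff⟩ : ∃ b, a ≠ b ∧ ∀ w, offMatching Γ f v w ↔ w = a ∨ w = b := by
    obtain ⟨x, y, hxy, hoff⟩ := h.off v
    rcases (hoff a).1 hv with rfl | rfl
    · exact ⟨y, hxy, hoff⟩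
    · exact ⟨x, hxy.symm, fun w => by rw [hoff, or_comm]⟩
  have hvf : v ≠ f v := (h.adj_f v).ne
  have hofff : ∀ w, offMatching Γ f (f v) w ↔ w = a ∨ w = b := fun w => by
    rw [← hoff]
    exact ⟨fun h1 => h.alt hfv hv h1, fun h1 => h.alt hv hfv h1⟩
  have hb : offMatching Γ f v b := (hoff b).2 (Or.inr rfl)
  have hpair : ∀ {x}, offMatching Γ f x v → offMatching Γ f x (f v) →
      ∀ w, offMatching Γ f x w ↔ w = v ∨ w = f v := by
    intro x h1 h2 w
    obtain ⟨y, z, hyz, hx⟩ := h.off x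
    rw [hx] at h1 h2 ⊢
    grind
  have hoa := hpair (h.off_symm hv) (h.off_symm hfv)
  have hob := hpair (h.off_symm hb) (h.off_symm ((hofff b).2 (Or.inr rfl)))
  have hfa : f a = b := by
    obtain ⟨g, hg⟩ := h.trans v a
    have h1 : offMatching Γ f a (g • a) := by rw [← hg, h.off_smul]; exact hg.symm ▸ hv
    have h2 : offMatching Γ f (f a) (g • a) := by
      rw [← hg, h.f_smul, h.off_smul]; exact hg.symm ▸ hfv
    have h3 := h.off_symm h2
    have h4 : f a = a ∨ f a = b := by
      rcases (hoa _).1 h1 with h5 | h5 <;> rw [h5] at h3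
      · exact (hoff _).1 h3
      · exact (hofff _).1 h3
    exact h4.resolve_left (h.adj_f a).ne.symm
  have hfb : f b = a := by rw [← hfa, h.f_f]
  have hva := hv.1.ne
  have hvb := hb.1.ne
  have hfa' := hfv.1.ne
  have hfb' := ((hofff b).2 (Or.inr rfl)).1.ne
  refine hconn.nonempty_iso_completeGraph ![v, f v, a, b] ?_ ?_
  · intro i j hij
    fin_cases i <;> fin_cases j <;> simp_all
  · intro i w
    rw [h.adj_cases]
    fin_cases i
    · simp [hoff, Fin.exists_fin_succ]
    · simp [hofff, h.f_f, Fin.exists_fin_succ]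
    · simp [hoa, hfa, Fin.exists_fin_succ]; tauto
    · simp [hob, hfb, Fin.exists_fin_succ]; tauto

/-- Unless the graph is complete, it is bipartite. -/
theorem exists_coloring (h : IsMatchedCubic Γ N f) [N.Normal]
    (hc : ∀ m ∈ N, ∀ n ∈ N, m * n = n * m) (hconn : Γ.Connected)
    (hno : ∀ v a, offMatching Γ f v a → ¬ offMatching Γ f (f v) a) :
    ∃ c : V → Prop, (∀ v, c (f v) ↔ ¬ c v) ∧ ∀ v w, offMatching Γ f v w → (c w ↔ ¬ c v) := by
  -- Modulo `M`-orbits, the two off-matching neighbours of a vertex are identified, so the two kinds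
  -- of edges become two involutions on the orbits.
  let M : Subgroup G := Subgroup.closure {n | n ∈ N ∧ ∃ v : V, n • v = v}
  have hMN : M ≤ N := (Subgroup.closure_le _).2 fun n hn => hn.1
  have hmem : ∀ {n : G} {v : V}, n ∈ N → n • v = v → n ∈ M := fun hn hv =>
    Subgroup.subset_closure ⟨hn, _, hv⟩
  let E : Setoid V :=
    { r := fun u w => ∃ n ∈ M, n • u = w
      iseqv := by
        refine ⟨fun u => ⟨1, M.one_mem, one_smul _ _⟩, ?_, ?_⟩
        · rintro u _ ⟨n, hn, rfl⟩
          exact ⟨n⁻¹, M.inv_mem hn, by simp⟩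
        · rintro u _ _ ⟨n, hn, rfl⟩ ⟨m, hm, rfl⟩
          exact ⟨m * n, M.mul_mem hm hn, mul_smul _ _ _⟩ }
  choose s hs using h.exists_off
  have hEoff : ∀ {v w a b}, E v w → offMatching Γ f v a → offMatching Γ f w b → E a b := by
    rintro v _ a b ⟨n, hn, rfl⟩ ha hb
    obtain ⟨m, hm, hmv, rfl⟩ := h.swap ((h.off_smul n v a).2 ha) hb
    exact ⟨m * n, M.mul_mem (hmem hm hmv) hn, mul_smul _ _ _⟩
  have hEf : ∀ {v w}, E v w → E (f v) (f w) := by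
    rintro v _ ⟨n, hn, rfl⟩
    exact ⟨n, hn, (h.f_smul n v).symm⟩
  -- Stabilisers are constant on `M`-orbits, but `N_v` moves `s v`.
  have hS0 : ∀ v, ¬ E v (s v) := by
    rintro v ⟨n, hn, hnv⟩
    obtain ⟨a, b, hab, hoff⟩ := h.off v
    obtain ⟨m, hm, hmv, hma⟩ := h.swap ((hoff a).2 (Or.inl rfl)) ((hoff b).2 (Or.inr rfl))
    have h1 : m ∈ fixer N (s v) := by
      rw [← hnv, fixer_smul_of_comm hc (hMN hn)]; exact mem_fixer.2 ⟨hm, hmv⟩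
    have h2 := (mem_fixer.1 h1).2
    rcases (hoff _).1 (hs v) with h3 | h3
    · rw [h3, hma] at h2
      exact hab h2.symm
    · rw [h3, ← hma] at h2
      exact hab ((smul_left_cancel m h2).symm.trans hma)
  -- If `f v = n • v`, there are at most two `N`-orbits, those of `v` and `a`, so `M` is `N_a N_v`.
  -- Writing `n = p q` gives `f v = p • v`, which is joined to `p • a = a`, against `hno`.
  have hF0 : ∀ v, ¬ E v (f v) := by
    rintro v ⟨n, hn, hnv⟩
    obtain ⟨a, ha⟩ := h.exists_off v
    have hfa : ∃ m ∈ N, m • a = f a := by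
      obtain ⟨g, rfl⟩ := h.trans v a
      refine ⟨g * n * g⁻¹, Subgroup.Normal.conj_mem ‹_› n (hMN hn) g, ?_⟩
      simp [mul_smul, hnv, h.f_smul]
    obtain ⟨m, hm, hma⟩ := hfa
    have hall : ∀ u, (∃ k ∈ N, u = k • v) ∨ ∃ k ∈ N, u = k • a := by
      refine hconn.forall_of_closed (v₀ := v) (Or.inl ⟨1, N.one_mem, by simp⟩) ?_
      intro u w huw hu
      rcases (h.adj_cases u w).1 huw with rfl | huw
      · rcases hu with ⟨k, hk, rfl⟩ | ⟨k, hk, rfl⟩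
        · exact Or.inl ⟨k * n, N.mul_mem hk (hMN hn), by rw [h.f_smul, ← hnv, mul_smul]⟩
        · exact Or.inr ⟨k * m, N.mul_mem hk hm, by rw [h.f_smul, ← hma, mul_smul]⟩
      · rcases hu with ⟨k, hk, rfl⟩ | ⟨k, hk, rfl⟩
        · obtain ⟨l, hl, -, rfl⟩ := h.swap ((h.off_smul k v a).2 ha) huw
          exact Or.inr ⟨l * k, N.mul_mem hl hk, (mul_smul _ _ _).symm⟩
        · obtain ⟨l, hl, -, rfl⟩ := h.swap ((h.off_smul k a v).2 (h.off_symm ha)) huw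
          exact Or.inl ⟨l * k, N.mul_mem hl hk, (mul_smul _ _ _).symm⟩
    have hprod : ∀ k ∈ M, ∃ p q : G, p ∈ fixer N a ∧ q ∈ fixer N v ∧ k = p * q := by
      intro k hk
      induction hk using Subgroup.closure_induction with
      | mem k hk =>
        obtain ⟨hk, u, hu⟩ := hk
        have h1 : k ∈ fixer N u := mem_fixer.2 ⟨hk, hu⟩
        rcases hall u with ⟨l, hl, rfl⟩ | ⟨l, hl, rfl⟩ <;> rw [fixer_smul_of_comm hc hl] at h1
        · exact ⟨1, k, one_mem _, h1, by simp⟩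
        · exact ⟨k, 1, h1, one_mem _, by simp⟩
      | one => exact ⟨1, 1, one_mem _, one_mem _, by simp⟩
      | mul x y _ _ hx hy =>
        obtain ⟨p, q, hp, hq, rfl⟩ := hx
        obtain ⟨p', q', hp', hq', rfl⟩ := hy
        refine ⟨p * p', q * q', mul_mem hp hp', mul_mem hq hq', ?_⟩
        rw [mul_assoc p, ← mul_assoc q, hc q (mem_fixer.1 hq).1 p' (mem_fixer.1 hp').1]
        simp only [mul_assoc]
      | inv x _ hx =>
        obtain ⟨p, q, hp, hq, rfl⟩ := hx
        refine ⟨p⁻¹, q⁻¹, inv_mem hp, inv_mem hq, ?_⟩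
        rw [hc p (mem_fixer.1 hp).1 q (mem_fixer.1 hq).1, mul_inv_rev]
    obtain ⟨p, q, hp, hq, rfl⟩ := hprod n hn
    refine hno v a ha ?_
    have h1 := (h.off_smul p v a).2 ha
    rwa [(mem_fixer.1 hp).2, ← (mem_fixer.1 hq).2, ← mul_smul, hnv] at h1
  let F₀ : Quotient E → Quotient E := Quotient.map f fun _ _ => hEf
  let S₀ : Quotient E → Quotient E := Quotient.map s fun _ _ huw => hEoff huw (hs _) (hs _)
  have hFi : Function.Involutive F₀ := by
    intro x
    obtain ⟨v, rfl⟩ := Quotient.exists_rep x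
    exact congrArg (Quotient.mk E) (h.f_f v)
  have hSi : Function.Involutive S₀ := by
    intro x
    obtain ⟨v, rfl⟩ := Quotient.exists_rep x
    exact Quotient.sound (hEoff (E.refl _) (hs (s v)) (h.off_symm (hs v)))
  obtain ⟨v₀⟩ := hconn.nonempty
  obtain ⟨c, hcF, hcS⟩ := exists_coloring_of_involutions hFi.toPerm hSi.toPerm
    (Equiv.ext hFi) (Equiv.ext hSi) (fun x hx => by
      obtain ⟨v, rfl⟩ := Quotient.exists_rep x
      exact hF0 v (E.symm (Quotient.exact hx)))
    (fun x hx => by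
      obtain ⟨v, rfl⟩ := Quotient.exists_rep x
      exact hS0 v (E.symm (Quotient.exact hx)))
    (Quotient.mk E v₀) (fun P h0 hPF hPS x => by
      obtain ⟨v, rfl⟩ := Quotient.exists_rep x
      refine hconn.forall_of_closed (P := fun v => P (Quotient.mk E v)) h0 ?_ v
      intro u w huw hu
      rcases (h.adj_cases u w).1 huw with rfl | huw
      · exact hPF _ hu
      · rw [← Quotient.sound (hEoff (E.refl _) (hs u) huw)]
        exact hPS _ hu)
  refine ⟨fun v => c (Quotient.mk E v), fun v => hcF (Quotient.mk E v), fun v w hvw => ?_⟩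
  have h1 : Quotient.mk E (s v) = Quotient.mk E w := Quotient.sound (hEoff (E.refl _) (hs v) hvw)
  change c (Quotient.mk E w) ↔ _
  rw [← h1]
  exact hcS (Quotient.mk E v)

end IsMatchedCubic

end Graph

/-! ### Contracting the matching of a bipartite graph -/

namespace IsMatchedCubic

variable {V : Type*} {Γ : SimpleGraph V} {G : Type*} [Group G] [MulAction G V]
  {N : Subgroup G} {f : V → V}

/-- The subgroup of the elements mapping the colour class `c` onto itself. -/
def colorSubgroup (G : Type*) [Group G] [MulAction G V] (c : V → Prop) : Subgroup G where
  carrier := {g | ∀ v : V, c (g • v) ↔ c v}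
  one_mem' v := by simp
  mul_mem' {a b} ha hb v := by rw [mul_smul, ha, hb]
  inv_mem' {a} ha v := by rw [← ha, smul_inv_smul]

/-- The action on one colour class of the group preserving it. -/
abbrev colorAction (G : Type*) [Group G] [MulAction G V] (c : V → Prop) :
    MulAction (colorSubgroup G c) {v // c v} where
  smul g v := ⟨g.1 • v.1, (g.2 v.1).2 v.2⟩
  one_smul v := Subtype.ext (one_smul G v.1)
  mul_smul g k v := Subtype.ext (mul_smul g.1 k.1 v.1)

/-- Contracting the matching of a bipartite matched cubic graph gives an alternating digraph,
with arcs leading from the second colour class to the first. -/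
theorem isAltDigraph (h : IsMatchedCubic Γ N f) (hconn : Γ.Connected) {c : V → Prop}
    (hcf : ∀ v, c (f v) ↔ ¬ c v) (hco : ∀ v w, offMatching Γ f v w → (c w ↔ ¬ c v))
    (hfaith : ∀ n ∈ N, (∀ v : V, n • v = v) → n = 1)
    (hns : ∃ n ∈ N, n ≠ 1 ∧ ∃ v : V, n • v = v) :
    let _ := colorAction G c
    IsAltDigraph (N.subgroupOf (colorSubgroup G c))
      (fun a b : {v // c v} => offMatching Γ f (f a) b) := by
  let _ := colorAction G c
  have hcadj : ∀ v w, Γ.Adj v w → (c w ↔ ¬ c v) := by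
    intro v w hvw
    rcases (h.adj_cases v w).1 hvw with rfl | hvw
    · exact hcf v
    · exact hco v w hvw
  -- In a connected bipartite graph, an automorphism keeping the colour of one vertex keeps all
  -- colours. In particular elements with a fixed point survive in the smaller group.
  have hmemH : ∀ {g : G} {v : V}, (c (g • v) ↔ c v) → g ∈ colorSubgroup G c := by
    intro g v hv
    refine hconn.forall_of_closed (P := fun v => c (g • v) ↔ c v) hv ?_
    intro u w huw hu
    rw [hcadj _ _ ((h.adj_iff g u w).2 huw), hcadj _ _ huw, hu]
  have hncf : ∀ {v}, ¬ c v → c (f v) := fun {v} hv => (hcf v).2 hv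
  have hcf' : ∀ {v}, c v → ¬ c (f v) := fun {v} hv hv' => (hcf v).1 hv' hv
  have hoc : ∀ {v w}, c v → offMatching Γ f (f v) w → c w := fun {v w} hv hvw =>
    (hco _ _ hvw).2 (hcf' hv)
  have hff : ∀ {v w}, f v = f w → v = w := fun {v w} hvw => by rw [← h.f_f v, hvw, h.f_f]
  refine
    { smul_iff := fun g a b => ?_
      trans := fun a b => ?_
      out := fun a => ?_
      inn := fun a => ?_
      alt := fun h1 h2 h3 => h.alt h1 h2 h3
      conn := ?_
      faithful := fun n hn hfix => ?_
      nonsemi := ?_ }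
  · change offMatching Γ f (f (g.1 • a.1)) (g.1 • b.1) ↔ _
    rw [h.f_smul, h.off_smul]
  · obtain ⟨g, hg⟩ := h.trans a.1 b.1
    have hgH : g ∈ colorSubgroup G c := hmemH (v := a.1) (by rw [hg]; simp [a.2, b.2])
    exact ⟨⟨g, hgH⟩, Subtype.ext hg⟩
  · obtain ⟨x, y, hxy, hoff⟩ := h.off (f a)
    refine ⟨⟨x, hoc a.2 ((hoff x).2 (Or.inl rfl))⟩, ⟨y, hoc a.2 ((hoff y).2 (Or.inr rfl))⟩, ?_, ?_⟩
    · simpa using hxy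
    · intro z
      rw [hoff]
      simp [Subtype.ext_iff]
  · obtain ⟨x, y, hxy, hoff⟩ := h.off a
    have hx : c (f x) := hncf ((not_congr (hco _ _ ((hoff x).2 (Or.inl rfl)))).2 (by simp [a.2]))
    have hy : c (f y) := hncf ((not_congr (hco _ _ ((hoff y).2 (Or.inr rfl)))).2 (by simp [a.2]))
    refine ⟨⟨f x, hx⟩, ⟨f y, hy⟩, fun h1 => hxy (hff (congrArg Subtype.val h1)), fun z => ?_⟩
    have h1 : offMatching Γ f (f z) a ↔ offMatching Γ f a (f z) := ⟨h.off_symm, h.off_symm⟩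
    rw [h1, hoff, Subtype.ext_iff, Subtype.ext_iff]
    constructor
    · rintro (h2 | h2)
      · exact Or.inl ((h.f_f _).symm.trans (congrArg f h2))
      · exact Or.inr ((h.f_f _).symm.trans (congrArg f h2))
    · rintro (h2 | h2)
      · exact Or.inl (by rw [h2, h.f_f])
      · exact Or.inr (by rw [h2, h.f_f])
  · intro a b
    let E := Relation.EqvGen (fun a b : {v // c v} => offMatching Γ f (f a) b)
    have key : ∀ v, (∀ hv : c v, E a ⟨v, hv⟩) ∧ ∀ hv : ¬ c v, E a ⟨f v, hncf hv⟩ := by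
      refine hconn.forall_of_closed (v₀ := a.1)
        ⟨fun _ => .refl _, fun hv => absurd a.2 hv⟩ ?_
      rintro v w hvw ⟨h1, h2⟩
      rcases (h.adj_cases v w).1 hvw with rfl | hvw
      · refine ⟨fun hw => h2 ((hcf v).1 hw), fun hw => ?_⟩
        have hv : c v := by by_contra hv; exact hw (hncf hv)
        convert h1 hv using 2
        exact h.f_f v
      · refine ⟨fun hw => ?_, fun hw => ?_⟩
        · have hv := (hco _ _ hvw).1 hw
          refine .trans _ _ _ (h2 hv) (.rel _ _ ?_)
          change offMatching Γ f (f (f v)) w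
          rwa [h.f_f]
        · have hv : c v := by by_contra hv; exact hw ((hco _ _ hvw).2 hv)
          refine .trans _ _ _ (h1 hv) (.symm _ _ (.rel _ _ ?_))
          change offMatching Γ f (f (f w)) v
          rw [h.f_f]
          exact h.off_symm hvw
    exact (key b.1).1 b.2
  · refine Subtype.ext (hfaith n.1 hn fun v => ?_)
    have h1 : ∀ u, c u → n.1 • u = u := fun u hu => congrArg Subtype.val (hfix ⟨u, hu⟩)
    by_cases hv : c v
    · exact h1 v hv
    · have h2 := h1 _ (hncf hv)
      rw [← h.f_smul] at h2
      exact hff h2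
  · obtain ⟨n, hn, hn1, v, hv⟩ := hns
    refine ⟨⟨n, hmemH (v := v) (by rw [hv])⟩, hn, fun h1 => hn1 (congrArg Subtype.val h1), ?_⟩
    by_cases hcv : c v
    · exact ⟨⟨v, hcv⟩, Subtype.ext hv⟩
    · refine ⟨⟨f v, hncf hcv⟩, Subtype.ext ?_⟩
      change n • f v = f v
      rw [← h.f_smul, hv]

/-- A bipartite matched cubic graph is the split graph of its contraction. -/
theorem nonempty_iso_digraphSplit (h : IsMatchedCubic Γ N f) {c : V → Prop}
    (hcf : ∀ v, c (f v) ↔ ¬ c v) (hco : ∀ v w, offMatching Γ f v w → (c w ↔ ¬ c v)) :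
    Nonempty (Γ ≃g digraphSplit (fun a b : {v // c v} => offMatching Γ f (f a) b)) := by
  have hcf' : ∀ {v}, c v → ¬ c (f v) := fun {v} hv hv' => (hcf v).1 hv' hv
  have hff : ∀ {v w}, f v = f w ↔ v = w :=
    fun {v w} => ⟨fun hvw => by rw [← h.f_f v, hvw, h.f_f], fun hvw => by rw [hvw]⟩
  let φ : {v // c v} × Bool → V := fun p => if p.2 then f p.1 else p.1
  have hinj : Function.Injective φ := by
    rintro ⟨⟨v, hv⟩, b⟩ ⟨⟨w, hw⟩, b'⟩ h1
    cases b <;> cases b' <;> simp only [φ, if_true, if_false, Bool.false_eq_true] at h1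
    · simp [h1]
    · exact absurd (h1 ▸ hv) (hcf' hw)
    · exact absurd (h1 ▸ hw) (hcf' hv)
    · simp [hff.1 h1]
  have hsurj : Function.Surjective φ := by
    intro v
    by_cases hv : c v
    · exact ⟨⟨⟨v, hv⟩, false⟩, rfl⟩
    · exact ⟨⟨⟨f v, (hcf v).2 hv⟩, true⟩, h.f_f v⟩
  refine ⟨RelIso.symm ⟨Equiv.ofBijective φ ⟨hinj, hsurj⟩, ?_⟩⟩
  rintro ⟨⟨v, hv⟩, b⟩ ⟨⟨w, hw⟩, b'⟩
  change Γ.Adj (φ _) (φ _) ↔ _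
  have hsym : ∀ {v w}, offMatching Γ f v w ↔ offMatching Γ f w v := ⟨h.off_symm, h.off_symm⟩
  rw [h.adj_cases]
  cases b <;> cases b' <;> simp only [φ, if_true, if_false, Bool.false_eq_true, digraphSplit]
  · have h1 : w ≠ f v := fun h1 => hcf' hv (h1 ▸ hw)
    have h2 : ¬ offMatching Γ f v w := fun h2 => (hco _ _ h2).1 hw hv
    simp [h1, h2]
  · simp [hff, hsym (v := v), eq_comm]
  · simp [h.f_f, eq_comm]
  · have h1 : f w ≠ f (f v) := fun h1 => hcf' hw (h1 ▸ (h.f_f v).symm ▸ hv)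
    have h2 : ¬ offMatching Γ f (f v) (f w) :=
      fun h2 => hcf' hw ((hco _ _ h2).2 (hcf' hv))
    simp [h1, h2]

end IsMatchedCubic

/-! ### Shift digraphs, the cube and split Praeger-Xu graphs -/

section ShiftGraph

/-- The split of the shift digraph with `r = 2`, `s = 1` is the cube. -/
theorem nonempty_digraphSplit_shiftRel_iso_cubeGraph :
    Nonempty (digraphSplit (shiftRel 2 1) ≃g cubeGraph 3) := by
  -- Matching edges flip only the third coordinate. Along an arc the layer changes, so exactly one
  -- of letter and letter plus layer changes, while the third coordinates of the two ends agree.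
  let φ : (((Fin 1 → ZMod 2) × ZMod 2) × Bool) → (Fin 3 → ZMod 2) := fun p =>
    ![p.1.1 0, p.1.1 0 + p.1.2, p.1.2 + if p.2 then 1 else 0]
  have hbij : Function.Bijective φ := by decide
  have hadj : ∀ p q : ((Fin 1 → ZMod 2) × ZMod 2) × Bool,
      hammingDist (φ p) (φ q) = 1 ↔ (digraphSplit (shiftRel 2 1)).Adj p q := by
    unfold digraphSplit shiftRel
    decide
  exact ⟨⟨Equiv.ofBijective φ hbij, fun {p q} => hadj p q⟩⟩

variable {r s : ℕ}

theorem wordCons_injective {a b : ZMod 2} {n m : Fin (s - 1) → ZMod 2}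
    (h : (wordCons a n : Fin s → ZMod 2) = wordCons b m) : n = m := by
  funext i
  have h1 := congrFun h ⟨i.val + 1, by omega⟩
  simpa [wordCons] using h1

/-- A cycle occupies the layers `x` and `x + 1`; since `2 ≠ 0` in `ZMod r`, this pair determines
which layer is first. -/
theorem naturalCycle_injective (hr : 3 ≤ r) {n m : Fin (s - 1) → ZMod 2} {x y : ZMod r}
    (h : naturalCycle r s n x = naturalCycle r s m y) : n = m ∧ x = y := by
  have : Fact (1 < r) := ⟨by omega⟩
  have h2 : (2 : ZMod r) ≠ 0 := by
    have := (ZMod.natCast_eq_zero_iff 2 r).not.2 (fun h => by have := Nat.le_of_dvd two_pos h; omega)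
    exact_mod_cast this
  have hv := congrArg SimpleGraph.Subgraph.verts h
  have hxy : x = y := by
    have h3 : ((wordCons 0 n, x) : (Fin s → ZMod 2) × ZMod r) ∈ (naturalCycle r s m y).verts := by
      rw [← hv]; exact ⟨0, Or.inl rfl⟩
    have h4 : ((wordCons 0 m, y) : (Fin s → ZMod 2) × ZMod r) ∈ (naturalCycle r s n x).verts := by
      rw [hv]; exact ⟨0, Or.inl rfl⟩
    obtain ⟨a, h3 | h3⟩ := h3
    · exact congrArg Prod.snd h3
    · obtain ⟨b, h4 | h4⟩ := h4
      · exact (congrArg Prod.snd h4).symm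
      · have h5 : x = y + 1 := congrArg Prod.snd h3
        have h6 : y = x + 1 := congrArg Prod.snd h4
        exact absurd (by linear_combination -h5 - h6) h2
  subst hxy
  have h3 : ((wordCons 0 n, x) : (Fin s → ZMod 2) × ZMod r) ∈ (naturalCycle r s m x).verts := by
    rw [← hv]; exact ⟨0, Or.inl rfl⟩
  obtain ⟨a, h3 | h3⟩ := h3
  · exact ⟨wordCons_injective (congrArg Prod.fst h3), rfl⟩
  · have h4 : x = x + 1 := congrArg Prod.snd h3
    simp at h4

/-- The word without its first letter. -/
def wordTail (u : Fin s → ZMod 2) : Fin (s - 1) → ZMod 2 := fun i => u ⟨i.val + 1, by omega⟩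

/-- The word without its last letter. -/
def wordInit (u : Fin s → ZMod 2) : Fin (s - 1) → ZMod 2 := fun i => u ⟨i.val, by omega⟩

theorem wordCons_wordTail (hs : 1 ≤ s) (u : Fin s → ZMod 2) :
    wordCons (u ⟨0, hs⟩) (wordTail u) = u := by
  funext ⟨i, hi⟩
  cases i <;> simp [wordCons, wordTail]

theorem wordSnoc_wordInit (hs : 1 ≤ s) (u : Fin s → ZMod 2) :
    wordSnoc (wordInit u) (u ⟨s - 1, by omega⟩) = u := by
  funext ⟨i, hi⟩
  simp only [wordSnoc, wordInit]
  split_ifs with h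
  · rfl
  · exact congrArg u (Fin.ext (by simp; omega))

theorem wordTail_wordCons (a : ZMod 2) (n : Fin (s - 1) → ZMod 2) :
    wordTail (wordCons a n : Fin s → ZMod 2) = n := by
  funext i
  simp [wordCons, wordTail]

theorem wordInit_wordSnoc (n : Fin (s - 1) → ZMod 2) (a : ZMod 2) :
    wordInit (wordSnoc n a : Fin s → ZMod 2) = n := by
  funext i
  simp [wordSnoc, wordInit]

theorem shiftRel_iff (u v : (Fin s → ZMod 2) × ZMod r) :
    shiftRel r s u v ↔ v.2 = u.2 + 1 ∧ wordTail u.1 = wordInit v.1 := by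
  refine and_congr_right fun _ => ⟨fun h => funext fun i => h _ _ rfl, fun h i j hij => ?_⟩
  have h1 := congrFun h ⟨j.val, by omega⟩
  simp only [wordTail, wordInit] at h1
  rw [← h1]
  exact congrArg u.1 (Fin.ext hij)

/-- The split Praeger-Xu graph is the split of the shift digraph. -/
theorem nonempty_digraphSplit_shiftRel_iso_splitPraegerXu (hr : 3 ≤ r) (hs : 1 ≤ s) :
    Nonempty (digraphSplit (shiftRel r s) ≃g splitPraegerXu r s) := by
  have : Fact (1 < r) := ⟨by omega⟩
  -- Each vertex lies on two natural cycles: the out-end goes with the one leading to the next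
  -- layer, the in-end with the one coming from the previous layer. An arc joins an out-end to an
  -- in-end with the same label.
  let cyc : ((Fin s → ZMod 2) × ZMod r) × Bool → (Fin (s - 1) → ZMod 2) × ZMod r := fun p =>
    if p.2 then (wordTail p.1.1, p.1.2) else (wordInit p.1.1, p.1.2 - 1)
  have hmem : ∀ p, p.1 ∈ (naturalCycle r s (cyc p).1 (cyc p).2).verts := by
    rintro ⟨⟨u, x⟩, _ | _⟩
    · exact ⟨u ⟨s - 1, by omega⟩, Or.inr (Prod.ext (wordSnoc_wordInit hs u).symm (by simp [cyc]))⟩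
    · exact ⟨u ⟨0, hs⟩, Or.inl (Prod.ext (wordCons_wordTail hs u).symm rfl)⟩
  have hcyc : ∀ p q, naturalCycle r s (cyc p).1 (cyc p).2 = naturalCycle r s (cyc q).1 (cyc q).2 ↔
      cyc p = cyc q := fun p q =>
    ⟨fun h => Prod.ext (naturalCycle_injective hr h).1 (naturalCycle_injective hr h).2,
      fun h => by rw [h]⟩
  let φ : ((Fin s → ZMod 2) × ZMod r) × Bool →
      {p : ((Fin s → ZMod 2) × ZMod r) × (praegerXu r s).Subgraph //
        p.2 ∈ naturalCycleDecomposition r s ∧ p.1 ∈ p.2.verts} := fun p =>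
    ⟨(p.1, naturalCycle r s (cyc p).1 (cyc p).2), ⟨_, _, rfl⟩, hmem p⟩
  have hends : ∀ u, cyc (u, true) ≠ cyc (u, false) := fun u h => by
    have := congrArg Prod.snd h
    simp only [cyc, if_true, if_false, Bool.false_eq_true] at this
    exact one_ne_zero (α := ZMod r) (by linear_combination this)
  have hinj : Function.Injective φ := by
    rintro ⟨u, b⟩ ⟨v, b'⟩ h
    have h1 : u = v := congrArg (fun p => p.1.1) h
    have h2 := (hcyc _ _).1 (congrArg (fun p => p.1.2) h)
    subst h1
    cases b <;> cases b'
    · rfl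
    · exact absurd h2.symm (hends u)
    · exact absurd h2 (hends u)
    · rfl
  have hsurj : Function.Surjective φ := by
    rintro ⟨⟨u, C⟩, hC, hu⟩
    have hC' : ∃ n x, C = naturalCycle r s n x := hC
    obtain ⟨n, x, rfl⟩ := hC'
    have hu' : ∃ a : ZMod 2, u = (wordCons a n, x) ∨ u = (wordSnoc n a, x + 1) := hu
    obtain ⟨a, rfl | rfl⟩ := hu'
    · refine ⟨⟨_, true⟩, Subtype.ext (Prod.ext rfl ?_)⟩
      simp [φ, cyc, wordTail_wordCons]
    · refine ⟨⟨_, false⟩, Subtype.ext (Prod.ext rfl ?_)⟩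
      simp [φ, cyc, wordInit_wordSnoc]
  refine ⟨⟨Equiv.ofBijective φ ⟨hinj, hsurj⟩, ?_⟩⟩
  intro p q
  have hadj : (splitPraegerXu r s).Adj (φ p) (φ q) ↔ (cyc p ≠ cyc q ∧ p.1 = q.1) ∨
      (cyc p = cyc q ∧ (naturalCycle r s (cyc p).1 (cyc p).2).Adj p.1 q.1) :=
    or_congr (and_congr_left' (not_congr (hcyc p q))) (and_congr_left' (hcyc p q))
  have hcadj : ∀ n x u v, (naturalCycle r s n x).Adj u v ↔
      (u.2 = x ∧ wordTail u.1 = n ∧ v.2 = x + 1 ∧ wordInit v.1 = n) ∨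
      (v.2 = x ∧ wordTail v.1 = n ∧ u.2 = x + 1 ∧ wordInit u.1 = n) := by
    intro n x u v
    constructor
    · rintro ⟨-, a, b, ⟨rfl, rfl⟩ | ⟨rfl, rfl⟩⟩
      · exact Or.inl ⟨rfl, wordTail_wordCons _ _, rfl, wordInit_wordSnoc _ _⟩
      · exact Or.inr ⟨rfl, wordTail_wordCons _ _, rfl, wordInit_wordSnoc _ _⟩
    · rintro (⟨h1, h2, h3, h4⟩ | ⟨h1, h2, h3, h4⟩)
      · refine ⟨fun h => ?_, u.1 ⟨0, hs⟩, v.1 ⟨s - 1, by omega⟩, Or.inl ⟨Prod.ext ?_ h1, Prod.ext ?_ h3⟩⟩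
        · rw [← h, h1] at h3; simp at h3
        · rw [← h2]; exact (wordCons_wordTail hs _).symm
        · rw [← h4]; exact (wordSnoc_wordInit hs _).symm
      · refine ⟨fun h => ?_, v.1 ⟨0, hs⟩, u.1 ⟨s - 1, by omega⟩, Or.inr ⟨Prod.ext ?_ h1, Prod.ext ?_ h3⟩⟩
        · rw [h, h1] at h3; simp at h3
        · rw [← h2]; exact (wordCons_wordTail hs _).symm
        · rw [← h4]; exact (wordSnoc_wordInit hs _).symm
  refine hadj.trans ?_
  rw [hcadj]
  obtain ⟨u, b⟩ := p
  obtain ⟨v, b'⟩ := q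
  cases b <;> cases b'
  · simp only [cyc, digraphSplit, if_false, Bool.false_eq_true]
    grind
  · simp only [cyc, digraphSplit, shiftRel_iff, if_false, if_true, Bool.false_eq_true]
    grind
  · simp only [cyc, digraphSplit, shiftRel_iff, if_false, if_true, Bool.false_eq_true]
    grind
  · simp only [cyc, digraphSplit, if_true]
    grind

end ShiftGraph

/-! ### Assembling the cases -/

theorem theorem1p2 {V : Type*} [Finite V] (Γ : SimpleGraph V) [Γ.LocallyFinite]
    (hconn : Γ.Connected) (hcubic : Γ.IsRegularOfDegree 3)
    (G : Subgroup (Γ ≃g Γ)) (hG : IsVertexTransitive G)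
    (hN : ∃ N : Subgroup (Γ ≃g Γ), N ≤ G ∧ (N.subgroupOf G).Normal ∧
      IsMulCommutative N ∧ ¬ IsSemiregular N) :
    Nonempty (Γ ≃g SimpleGraph.completeGraph (Fin 4)) ∨
    Nonempty (Γ ≃g completeBipartiteGraph (Fin 3) (Fin 3)) ∨
    Nonempty (Γ ≃g cubeGraph 3) ∨
    ∃ r s : ℕ, 3 ≤ r ∧ 1 ≤ s ∧ s ≤ r - 1 ∧ Nonempty (Γ ≃g splitPraegerXu r s) := by
  obtain ⟨N, hNG, hNn, hNc, hNs⟩ := hN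
  have hfin : Finite (Γ ≃g Γ) :=
    Finite.of_injective (fun g : Γ ≃g Γ => (g : V → V)) DFunLike.coe_injective
  have hcomm : ∀ m ∈ N.subgroupOf G, ∀ n ∈ N.subgroupOf G, m * n = n * m := by
    intro m hm n hn
    have := congrArg Subtype.val (mul_comm' (⟨m.1, hm⟩ : N) ⟨n.1, hn⟩)
    exact Subtype.ext this
  have hcub : ∀ v, ∃ a b c, a ≠ b ∧ a ≠ c ∧ b ≠ c ∧ ∀ w, Γ.Adj v w ↔ w = a ∨ w = b ∨ w = c := by
    classical
    intro v
    obtain ⟨a, b, c, hab, hac, hbc, h⟩ := Finset.card_eq_three.1 (hcubic v)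
    refine ⟨a, b, c, hab, hac, hbc, fun w => ?_⟩
    rw [← SimpleGraph.mem_neighborFinset, h]
    simp
  have hadj : ∀ (g : G) (a b : V), Γ.Adj (g • a) (g • b) ↔ Γ.Adj a b := fun g a b =>
    g.1.map_adj_iff
  have htrans : ∀ a b : V, ∃ g : G, g • a = b := fun a b => by
    obtain ⟨g, hg, h⟩ := hG a b
    exact ⟨⟨g, hg⟩, h⟩
  have hfaith : ∀ n ∈ N.subgroupOf G, (∀ v : V, n • v = v) → n = 1 := fun n _ h =>
    Subtype.ext (RelIso.ext h)
  have hns : ∃ n ∈ N.subgroupOf G, n ≠ 1 ∧ ∃ v : V, n • v = v := by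
    unfold IsSemiregular at hNs
    push Not at hNs
    obtain ⟨n, hn, v, hv, hn1⟩ := hNs
    exact ⟨⟨n, hNG hn⟩, hn, fun h => hn1 (congrArg Subtype.val h), v, hv⟩
  rcases nonempty_iso_or_isMatchedCubic hcomm hconn hcub hadj htrans hfaith hns with h | ⟨f, h⟩
  · exact Or.inr (Or.inl h)
  by_cases hno : ∀ v a, offMatching Γ f v a → ¬ offMatching Γ f (f v) a
  · obtain ⟨c, hcf, hco⟩ := h.exists_coloring hcomm hconn hno
    let _ := IsMatchedCubic.colorAction G c
    obtain ⟨r, s, hs, ⟨φ, hφ⟩, hwalk⟩ :=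
      (h.isAltDigraph hconn hcf hco hfaith hns).exists_equiv_shiftRel (by
        intro m hm n hn
        exact Subtype.ext (hcomm m.1 hm n.1 hn))
    obtain ⟨e⟩ := h.nonempty_iso_digraphSplit hcf hco
    have e' := e.trans (digraphSplitIso φ hφ)
    obtain ⟨n, hn, hn1, a, ha⟩ := (h.isAltDigraph hconn hcf hco hfaith hns).nonsemi
    -- A fixed vertex is a fixed walk of length zero, so `s + 1 ≤ r`; below `r = 3` only `r = 2`, `s
    -- = 1` remains.
    have hsr := hwalk n hn hn1 0 (fun _ => a) (by simp) (fun _ _ => ha)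
    right; right
    by_cases hr : 3 ≤ r
    · obtain ⟨e''⟩ := nonempty_digraphSplit_shiftRel_iso_splitPraegerXu hr hs
      exact Or.inr ⟨r, s, hr, hs, by omega, ⟨e'.trans e''⟩⟩
    · obtain rfl : r = 2 := by omega
      obtain rfl : s = 1 := by omega
      obtain ⟨e''⟩ := nonempty_digraphSplit_shiftRel_iso_cubeGraph
      exact Or.inl ⟨e'.trans e''⟩
  · push Not at hno
    obtain ⟨v, a, hv, hfv⟩ := hno
    exact Or.inl (h.nonempty_iso_completeGraph hconn hv hfv)
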